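/- Let $\alpha>0$ and let $\rho_-,\rho_+:[0,\infty)\to(0,1)$ be Lipschitz continuous. For $N\ge1$ put $\Lambda_N=\{-N,\dots,N\}$ and let $(\eta_u)_{u\ge0}$ be the time-inhomogeneous Markov jump process on $\{0,1\}^{\Lambda_N}$ whose generator at time $u$ is $L_{\mathrm{exc}}+L_{b,N^{-2-\alpha}u}$, where $$L_{\mathrm{exc}}f(\eta)=\tfrac12\sum_{x=-N}^{N-1}\big(f(\eta^{(x,x+1)})-f(\eta)\big),\qquad L_{b,t}f(\eta)=\sum_{\sigma=\pm}\rho_\sigma(t)^{1-\eta(\sigma N)}(1-\rho_\sigma(t))^{\eta(\sigma N)}\big(f(\eta^{\sigma N})-f(\eta)\big);$$ here $\eta^{(x,y)}$ is $\eta$ with the occupation numbers at $x$ and $y$ exchanged, and $\eta^x$ is $\eta$ with the occupation number at $x$ flipped. For each $N$ the process starts from an arbitrary configuration $\eta_0=\eta_0^{(N)}\in\{0,1\}^{\Lambda_N}$. Write $\mathbb E_{\eta_0}$ for the expectation, $\rho_N(x,u)=\mathbb E_{\eta_0}(\eta_u(x))$, and, for $x_1\ne x_2$ in $\Lambda_N$,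 $$v_N(x_1,x_2;u)=\mathbb E_{\eta_0}\big([\eta_u(x_1)-\rho_N(x_1,u)][\eta_u(x_2)-\rho_N(x_2,u)]\big).$$ Then for all $-1<r_1<r_2<1$ and all $t>0$, $$\lim_{N\to\infty}N\,v_N\big([Nr_1],[Nr_2];N^{2+\alpha}t\big)=-\frac14\,[\rho_+(t)-\rho_-(t)]^2\;\frac{(1+r_1)(1-r_2)}{2},$$ where $[\cdot]$ is the integer part. The factor $\frac{(1+r_1)(1-r_2)}2$ is the Green kernel of $-\frac{d^2}{dr^2}$ on $(-1,1)$ with Dirichlet boundary conditions. Furthermore, for all $0\le s<t$ and all sites $x=x_N,\ y=y_N\in\Lambda_N$ (which may depend on $N$ and may coincide), $$\lim_{N\to\infty}N\,\mathbb E_{\eta_0}\Big(\big[\eta_{N^{2+\alpha}s}(x)-\rho_N(x,N^{2+\alpha}s)\big]\big[\eta_{N^{2+\alpha}t}(y)-\rho_N(y,N^{2+\alpha}t)\big]\Big)=0 .$$ -/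

import Mathlib

open MeasureTheory ProbabilityTheory Filter Topology
open scoped NNReal

namespace QuasiStatic

/-- The lattice `Λ_N = {-N, …, N}`. -/
abbrev Site (N : ℕ) : Type := {x : ℤ // -(N : ℤ) ≤ x ∧ x ≤ N}

noncomputable instance instFintypeSite (N : ℕ) : Fintype (Site N) :=
  Fintype.subtype (Finset.Icc (-(N : ℤ)) N) (by simp)

/-- Configurations `η ∈ {0,1}^{Λ_N}`; `true` means that the site is occupied. -/
abbrev Config (N : ℕ) : Type := Site N → Bool

/-- The occupation number `η(x) ∈ {0,1}` as a real number. -/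
def occ {N : ℕ} (η : Config N) (x : Site N) : ℝ := if η x then 1 else 0

/-- The right end point `N`. -/
def rightEnd (N : ℕ) : Site N := ⟨N, by omega, le_rfl⟩

/-- The left end point `-N`. -/
def leftEnd (N : ℕ) : Site N := ⟨-(N : ℤ), le_rfl, by omega⟩

/-- `η^{(x,y)}`: the occupation numbers at `x` and `y` are exchanged. -/
def exchange {N : ℕ} (η : Config N) (x y : Site N) : Config N := fun z => η (Equiv.swap x y z)

/-- `η^x`: the occupation number at `x` is flipped. -/
def flipAt {N : ℕ} (η : Config N) (x : Site N) : Config N := Function.update η x (!(η x))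

/-- The bulk generator
`L_exc f(η) = (1/2) ∑_{x=-N}^{N-1} (f(η^{(x,x+1)}) - f(η))`. -/
noncomputable def genExc {N : ℕ} (f : Config N → ℝ) (η : Config N) : ℝ :=
  (1 / 2) * ∑ x : Site N, ∑ y : Site N,
    if (y : ℤ) = (x : ℤ) + 1 then f (exchange η x y) - f η else 0

/-- The rate `a^{1-η(x)} (1-a)^{η(x)}` at which a reservoir of density `a` flips site `x`. -/
noncomputable def flipRate {N : ℕ} (a : ℝ) (η : Config N) (x : Site N) : ℝ :=
  if η x then 1 - a else a

/-- The generator of the two reservoirs, with densities `a` on the left and `b` on the right. -/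
noncomputable def genBdry {N : ℕ} (a b : ℝ) (f : Config N → ℝ) (η : Config N) : ℝ :=
  flipRate b η (rightEnd N) * (f (flipAt η (rightEnd N)) - f η) +
    flipRate a η (leftEnd N) * (f (flipAt η (leftEnd N)) - f η)

/-- The generator at microscopic time `u`: `L_exc + L_{b, N^{-2-α} u}`. -/
noncomputable def gen (N : ℕ) (α : ℝ) (ρm ρp : ℝ → ℝ) (u : ℝ)
    (f : Config N → ℝ) (η : Config N) : ℝ :=
  genExc f η +
    genBdry (ρm ((N : ℝ) ^ (-2 - α) * u)) (ρp ((N : ℝ) ^ (-2 - α) * u)) f η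

/-- `X` is, under `P`, the (time-inhomogeneous) Markov jump process on `{0,1}^{Λ_N}` started from
`η₀` with generator `gen N α ρm ρp u` at time `u`: its paths are càdlàg, it starts from `η₀`, and it
solves the martingale problem for the generator with respect to its own filtration. -/
structure IsExclusionProcess {N : ℕ} (α : ℝ) (ρm ρp : ℝ → ℝ) (η₀ : Config N)
    {Ω : Type*} [MeasurableSpace Ω] (P : Measure Ω) (X : ℝ≥0 → Ω → Config N) : Prop where
  measurable : ∀ t, StronglyMeasurable (X t)
  rightCont : ∀ ω t, ContinuousWithinAt (fun u => X u ω) (Set.Ici t) t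
  leftLim : ∀ ω t, ∃ η : Config N, Tendsto (fun u => X u ω) (𝓝[<] t) (𝓝 η)
  initial : ∀ᵐ ω ∂P, X 0 ω = η₀
  martingale : ∀ f : Config N → ℝ,
    Martingale
      (fun (t : ℝ≥0) ω => f (X t ω) - f (X 0 ω) -
        ∫ u in (0 : ℝ)..t, gen N α ρm ρp u f (X u.toNNReal ω))
      (Filtration.natural X measurable) P

/-- `ρ_N(x, t) = E(η_t(x))`. -/
noncomputable def meanOcc {N : ℕ} {Ω : Type*} [MeasurableSpace Ω] (P : Measure Ω)
    (X : ℝ≥0 → Ω → Config N) (x : Site N) (t : ℝ≥0) : ℝ :=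
  ∫ ω, occ (X t ω) x ∂P

/-- `E([η_s(x) - ρ_N(x,s)] [η_t(y) - ρ_N(y,t)])`. -/
noncomputable def twoTimeCov {N : ℕ} {Ω : Type*} [MeasurableSpace Ω] (P : Measure Ω)
    (X : ℝ≥0 → Ω → Config N) (x : Site N) (s : ℝ≥0) (y : Site N) (t : ℝ≥0) : ℝ :=
  ∫ ω, (occ (X s ω) x - meanOcc P X x s) * (occ (X t ω) y - meanOcc P X y t) ∂P

/-- The equal-time covariance `v_N(x, y; t)`. -/
noncomputable def equalTimeCov {N : ℕ} {Ω : Type*} [MeasurableSpace Ω] (P : Measure Ω)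
    (X : ℝ≥0 → Ω → Config N) (x y : Site N) (t : ℝ≥0) : ℝ :=
  twoTimeCov P X x t y t

/-- The site `[N r]`, for `r ∈ (-1, 1)`. -/
noncomputable def macroSite (N : ℕ) (r : ℝ) (hr : r ∈ Set.Ioo (-1 : ℝ) 1) : Site N :=
  ⟨⌊(N : ℝ) * r⌋, by
    have hN : (0 : ℝ) ≤ N := Nat.cast_nonneg N
    constructor
    · rw [Int.le_floor]
      push_cast
      nlinarith [hr.1]
    · have h : (⌊(N : ℝ) * r⌋ : ℝ) ≤ N := (Int.floor_le _).trans (by nlinarith [hr.2])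
      exact_mod_cast h⟩

/-- The microscopic time `N^{2+α} t`. -/
noncomputable def microTime (N : ℕ) (α : ℝ) (t : ℝ≥0) : ℝ≥0 := (N : ℝ≥0) ^ (2 + α) * t

end QuasiStatic

/-! The generator maps occupation numbers, and products of two of them, to functions of the same
kind, so the first and second moments solve closed linear systems. The mean density solves the
discrete heat equation with source terms from the reservoirs. The truncated correlations solve the
equation of two exclusion particles killed at the ends, with source `-(∇ρ_N)²/2` on neighbouring
pairs only (`hasRightDerivFrom_cov`), and vanish at time 0 because the start is deterministic.

Relaxation takes time of order `N²`, while the reservoirs vary on the scale `N^(2+α)`: in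
microscopic time their Lipschitz constant is `κ = K N^(-2-α)`, so `κ N² → 0`. Hence at time `N^(2+α)
t` the system is close to stationarity. If the density gradient were the constant `ĉ = (ρ₊ -
ρ₋)/(2N+1)`, the exact stationary correlation would be `-ĉ²/(2N)` times the kernel `green`, since
`lap₂_green` says that the two-particle operator sends `green` to `-N` on neighbouring pairs and to
0 elsewhere. Multiplied by `N`, this tends to the claimed limit.

All errors are controlled by comparison with explicit supersolutions (`nonpos_of_rightDeriv_le`):
parabolas for bounded sources and initial data, `green` for sources on neighbouring pairs. The
delicate estimate is `abs_grad_sub_le`. The deviation of the density from the stationary profile is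
only `O(κ N²)`, and differencing that bound would gain nothing. The gradient itself, however, solves
a heat equation on the bonds whose boundary data are `O(κ N)`, because the parabola is only `O(N)`
at the ends. It is therefore within `O(κ N)` of `ĉ`, after an exponentially small transient. In
`abs_cov_add_le` this gives an error `O(κ N² + (κ N²)²)` for `N v_N`, plus a transient.

For two times, weight the moments by `Z`, the centred occupation at the earlier time. Since `Z` has
mean zero, the source drops out and the weighted means decay like `exp(-c N^α)`. -/

namespace QuasiStatic

/-! ### Comparison principle for systems of differential inequalities. -/

theorem hasDerivAt_max_zero_sq (x : ℝ) :
    HasDerivAt (fun y : ℝ => max y 0 ^ 2) (2 * max x 0) x := by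
  rcases lt_trichotomy x 0 with hx | rfl | hx
  · rw [max_eq_right hx.le, mul_zero]
    refine (hasDerivAt_const x (0 : ℝ)).congr_of_eventuallyEq ?_
    filter_upwards [eventually_lt_nhds hx] with y hy
    simp [max_eq_right hy.le]
  · rw [max_self, mul_zero, hasDerivAt_iff_isLittleO_nhds_zero]
    have h : (fun h : ℝ => max (0 + h) 0 ^ 2 - max (0 : ℝ) 0 ^ 2 - h • (0 : ℝ)) =O[𝓝 0]
        fun h : ℝ => h ^ 2 := by
      refine Asymptotics.IsBigO.of_bound 1 (Eventually.of_forall fun h => ?_)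
      simp only [zero_add, max_self, smul_zero, sub_zero, one_mul, norm_pow, Real.norm_eq_abs]
      norm_num
      rcases le_total h 0 with h' | h' <;> simp [h', sq_nonneg]
    exact h.trans_isLittleO (Asymptotics.isLittleO_pow_id one_lt_two)
  · rw [max_eq_left hx.le]
    have := (hasDerivAt_pow 2 x)
    refine (this.congr_of_eventuallyEq ?_).congr_deriv (by simp)
    filter_upwards [eventually_gt_nhds hx] with y hy
    simp [max_eq_left hy.le]

/-- Comparison principle for finite systems of differential inequalities with nonnegative
coupling. -/
theorem nonpos_of_rightDeriv_le {ι : Type*} (S : Finset ι) {D D' : ι → ℝ → ℝ} {s C : ℝ}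
    (hderiv : ∀ i ∈ S, ∀ u, s ≤ u → HasDerivWithinAt (D i) (D' i u) (Set.Ici u) u)
    (hcont : ∀ i ∈ S, ContinuousOn (D i) (Set.Ici s))
    (h0 : ∀ i ∈ S, D i s ≤ 0)
    (hle : ∀ i ∈ S, ∀ u, s ≤ u → 0 < D i u → D' i u ≤ C * ∑ j ∈ S, max (D j u) 0) :
    ∀ i ∈ S, ∀ u, s ≤ u → D i u ≤ 0 := by
  intro i hi T hT
  -- For negative `C` the right-hand side is nonpositive, so the hypothesis also holds with constant
  -- 0.
  wlog hC : 0 ≤ C generalizing C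
  · refine this (C := 0) (fun i hi u hu hpos => (hle i hi u hu hpos).trans ?_) le_rfl
    have : 0 ≤ ∑ j ∈ S, max (D j u) 0 := Finset.sum_nonneg fun j _ => le_max_right _ _
    nlinarith
  -- Squaring makes the positive part differentiable. Gronwall applied to `m`, which vanishes at
  -- `s`, forces `m = 0`.
  set m : ℝ → ℝ := fun u => ∑ j ∈ S, max (D j u) 0 ^ 2 with hm
  have hmd : ∀ u, s ≤ u → HasDerivWithinAt m
      (∑ j ∈ S, 2 * max (D j u) 0 * D' j u) (Set.Ici u) u := fun u hu =>
    HasDerivWithinAt.fun_sum fun j hj =>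
      (hasDerivAt_max_zero_sq (D j u)).comp_hasDerivWithinAt u (hderiv j hj u hu)
  have hmc : ContinuousOn m (Set.Icc s T) :=
    continuousOn_finsetSum _ fun j hj =>
      ((((hcont j hj).mono Set.Icc_subset_Ici_self)).sup continuousOn_const).pow 2
  have hm0 : m s = 0 := Finset.sum_eq_zero fun j hj => by simp [max_eq_right (h0 j hj)]
  have hbound : ∀ u ∈ Set.Ico s T, (∑ j ∈ S, 2 * max (D j u) 0 * D' j u) ≤
      (2 * C * S.card) * m u + 0 := by
    intro u hu
    set σ := ∑ j ∈ S, max (D j u) 0 with hσ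
    have h1 : (∑ j ∈ S, 2 * max (D j u) 0 * D' j u) ≤ ∑ j ∈ S, 2 * max (D j u) 0 * (C * σ) := by
      refine Finset.sum_le_sum fun j hj => ?_
      rcases le_or_gt (D j u) 0 with h | h
      · simp [max_eq_right h]
      · exact mul_le_mul_of_nonneg_left (hle j hj u hu.1 h) (by positivity)
    have h2 : ∑ j ∈ S, 2 * max (D j u) 0 * (C * σ) = 2 * C * σ ^ 2 := by
      rw [← Finset.sum_mul, ← Finset.mul_sum, ← hσ]; ring
    have h3 : σ ^ 2 ≤ S.card * m u := sq_sum_le_card_mul_sum_sq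
    rw [h2] at h1
    nlinarith
  have hg := le_gronwallBound_of_liminf_deriv_right_le hmc
    (fun u hu r hr => (hmd u hu.1).liminf_right_slope_le hr) hm0.le hbound T ⟨hT, le_rfl⟩
  rw [gronwallBound_ε0, zero_mul] at hg
  have hi2 : max (D i T) 0 ^ 2 ≤ 0 :=
    (Finset.single_le_sum (f := fun j => max (D j T) 0 ^ 2) (fun j _ => sq_nonneg _) hi).trans hg
  have : max (D i T) 0 = 0 := by nlinarith [le_max_right (D i T) 0, sq_nonneg (max (D i T) 0)]
  exact this ▸ le_max_left _ _

/-- The first function is continuous on `[s, ∞)`, with the second one as its right derivative. -/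
structure HasRightDerivFrom (s : ℝ) (f f' : ℝ → ℝ) : Prop where
  continuousOn : ContinuousOn f (Set.Ici s)
  hasDerivWithinAt : ∀ u, s ≤ u → HasDerivWithinAt f (f' u) (Set.Ici u) u

namespace HasRightDerivFrom

variable {s : ℝ} {f f' g g' : ℝ → ℝ}

theorem of_hasDerivAt (h : ∀ u, HasDerivAt f (f' u) u) : HasRightDerivFrom s f f' :=
  ⟨fun u _ => (h u).continuousAt.continuousWithinAt, fun u _ => (h u).hasDerivWithinAt⟩

theorem congr_deriv (hf : HasRightDerivFrom s f f') (h : ∀ u, s ≤ u → f' u = g' u) :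
    HasRightDerivFrom s f g' :=
  ⟨hf.1, fun u hu => (hf.2 u hu).congr_deriv (h u hu)⟩

theorem neg (hf : HasRightDerivFrom s f f') :
    HasRightDerivFrom s (fun u => -f u) (fun u => -f' u) :=
  ⟨hf.1.neg, fun u hu => (hf.2 u hu).neg⟩

theorem sub (hf : HasRightDerivFrom s f f') (hg : HasRightDerivFrom s g g') :
    HasRightDerivFrom s (fun u => f u - g u) (fun u => f' u - g' u) :=
  ⟨hf.1.sub hg.1, fun u hu => (hf.2 u hu).sub (hg.2 u hu)⟩

theorem add (hf : HasRightDerivFrom s f f') (hg : HasRightDerivFrom s g g') :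
    HasRightDerivFrom s (fun u => f u + g u) (fun u => f' u + g' u) :=
  ⟨hf.1.add hg.1, fun u hu => (hf.2 u hu).add (hg.2 u hu)⟩

theorem mul (hf : HasRightDerivFrom s f f') (hg : HasRightDerivFrom s g g') :
    HasRightDerivFrom s (fun u => f u * g u) (fun u => f' u * g u + f u * g' u) :=
  ⟨hf.1.mul hg.1, fun u hu => (hf.2 u hu).mul (hg.2 u hu)⟩

end HasRightDerivFrom

/-! ### One killed particle: decay from a parabolic supersolution. -/

/-- Generator of one particle on `{-N, …, N}`, jumping at rate `1/2` to each neighbour and killed at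
rate `1` at each end point. -/
noncomputable def lap (N : ℕ) (f : ℤ → ℝ) (x : ℤ) : ℝ :=
  (if x = N then -f x else (f (x + 1) - f x) / 2) +
    (if x = -N then -f x else (f (x - 1) - f x) / 2)

/-- Generator of two exclusion particles at `x < y` in `{-N, …, N}`, each jumping at rate `1/2` to
each free neighbour and killed at rate `1` at the end points. -/
noncomputable def lap₂ (N : ℕ) (f : ℤ → ℤ → ℝ) (x y : ℤ) : ℝ :=
  (if x = -N then -f x y else (f (x - 1) y - f x y) / 2) +
    (if y = N then -f x y else (f x (y + 1) - f x y) / 2) +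
    (if y = x + 1 then 0 else (f (x + 1) y - f x y) / 2 + (f x (y - 1) - f x y) / 2)

/-- A lower bound for the relaxation rate of one and two particles. -/
noncomputable def relRate (N : ℕ) : ℝ := 1 / (2 * ((N : ℝ) + 1) ^ 2)

theorem relRate_nonneg (N : ℕ) : 0 ≤ relRate N := by unfold relRate; positivity

theorem relRate_mul (N : ℕ) : relRate N * ((N : ℝ) + 1) ^ 2 = 1 / 2 := by
  unfold relRate; field_simp

theorem hasDerivAt_exp_relRate (N : ℕ) (s u : ℝ) :
    HasDerivAt (fun u => Real.exp (-relRate N * (u - s)))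
      (-relRate N * Real.exp (-relRate N * (u - s))) u := by
  have := ((((hasDerivAt_id u).sub_const s).const_mul (-relRate N))).exp
  refine this.congr_deriv ?_
  simp; ring

theorem lap_sub_mul (N : ℕ) (f h : ℤ → ℝ) (c : ℝ) (x : ℤ) :
    lap N (fun x => f x - c * h x) x = lap N f x - c * lap N h x := by
  unfold lap; split_ifs <;> ring

theorem lap_neg (N : ℕ) (f : ℤ → ℝ) (x : ℤ) : lap N (fun x => -f x) x = -lap N f x := by
  unfold lap; split_ifs <;> ring

theorem lap₂_neg (N : ℕ) (f : ℤ → ℤ → ℝ) (x y : ℤ) :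
    lap₂ N (fun x y => -f x y) x y = -lap₂ N f x y := by
  unfold lap₂; split_ifs <;> ring

/-- In the interior the two halved differences add up to exactly `-1`; at an end the killing makes
the value smaller still. -/
theorem lap_parabola_le (N : ℕ) (x : ℤ) :
    lap N (fun x => ((N : ℝ) + 1) ^ 2 - (x : ℝ) ^ 2) x ≤ -1 := by
  have hN : (0 : ℝ) ≤ N := Nat.cast_nonneg N
  unfold lap
  split_ifs with h1 h2 h2 <;> (try subst h1) <;> (try subst h2) <;> push_cast <;> nlinarith

theorem lap_nonpos {N : ℕ} {s : ℝ} {D D' : ℤ → ℝ → ℝ}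
    (hd : ∀ x ∈ Finset.Icc (-(N : ℤ)) N, HasRightDerivFrom s (D x) (D' x))
    (h0 : ∀ x ∈ Finset.Icc (-(N : ℤ)) N, D x s ≤ 0)
    (hle : ∀ x ∈ Finset.Icc (-(N : ℤ)) N, ∀ u, s ≤ u → D' x u ≤ lap N (fun x => D x u) x) :
    ∀ x ∈ Finset.Icc (-(N : ℤ)) N, ∀ u, s ≤ u → D x u ≤ 0 := by
  -- Where `D x u > 0`, the killing and outflow terms are negative; each of the two neighbours
  -- contributes at most half the sum of positive parts.
  refine nonpos_of_rightDeriv_le (C := 1) _ (fun x hx => (hd x hx).2) (fun x hx => (hd x hx).1) h0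
    fun x hx u hu hpos => (hle x hx u hu).trans ?_
  have key : ∀ z ∈ Finset.Icc (-(N : ℤ)) N,
      max (D z u) 0 ≤ ∑ j ∈ Finset.Icc (-(N : ℤ)) N, max (D j u) 0 := fun z hz =>
    Finset.single_le_sum (f := fun j => max (D j u) 0) (fun j _ => le_max_right _ _) hz
  have key' : ∀ z ∈ Finset.Icc (-(N : ℤ)) N,
      D z u ≤ ∑ j ∈ Finset.Icc (-(N : ℤ)) N, max (D j u) 0 := fun z hz =>
    (le_max_left _ _).trans (key z hz)
  have hs : 0 ≤ ∑ j ∈ Finset.Icc (-(N : ℤ)) N, max (D j u) 0 :=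
    Finset.sum_nonneg fun j _ => le_max_right _ _
  rw [Finset.mem_Icc] at hx
  have h1 : (if x = N then -D x u else (D (x + 1) u - D x u) / 2) ≤
      (∑ j ∈ Finset.Icc (-(N : ℤ)) N, max (D j u) 0) / 2 := by
    split_ifs with h
    · linarith
    · linarith [key' (x + 1) (Finset.mem_Icc.2 (by omega))]
  have h2 : (if x = -N then -D x u else (D (x - 1) u - D x u) / 2) ≤
      (∑ j ∈ Finset.Icc (-(N : ℤ)) N, max (D j u) 0) / 2 := by
    split_ifs with h
    · linarith
    · linarith [key' (x - 1) (Finset.mem_Icc.2 (by omega))]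
  unfold lap
  linarith

/-- Applied to the barrier, `lap` yields at most `-(E + θ)`, with `E` the exponential: `θ` absorbs
the source, and `E` pays for the time derivative because `relRate N` times the parabola is at most
1. At time `s` the parabola, being at least 1, dominates the data. -/
theorem le_barrier_of_lap {N : ℕ} {s θ : ℝ} {f F : ℤ → ℝ → ℝ} (hθ : 0 ≤ θ)
    (hd : ∀ x ∈ Finset.Icc (-(N : ℤ)) N,
      HasRightDerivFrom s (f x) (fun u => lap N (fun x => f x u) x + F x u))
    (hF : ∀ x ∈ Finset.Icc (-(N : ℤ)) N, ∀ u, s ≤ u → F x u ≤ θ)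
    (h0 : ∀ x ∈ Finset.Icc (-(N : ℤ)) N, f x s ≤ 1) :
    ∀ x ∈ Finset.Icc (-(N : ℤ)) N, ∀ u, s ≤ u →
      f x u ≤ (Real.exp (-relRate N * (u - s)) + θ) * (((N : ℝ) + 1) ^ 2 - (x : ℝ) ^ 2) := by
  have hh : ∀ x ∈ Finset.Icc (-(N : ℤ)) N, (1 : ℝ) ≤ ((N : ℝ) + 1) ^ 2 - (x : ℝ) ^ 2 := by
    intro x hx
    rw [Finset.mem_Icc] at hx
    have h1 : (-(N : ℝ)) ≤ x := by exact_mod_cast hx.1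
    have h2 : (x : ℝ) ≤ N := by exact_mod_cast hx.2
    nlinarith
  have hE : ∀ x : ℤ, HasRightDerivFrom s
      (fun u => (Real.exp (-relRate N * (u - s)) + θ) * (((N : ℝ) + 1) ^ 2 - (x : ℝ) ^ 2))
      (fun u => -relRate N * Real.exp (-relRate N * (u - s)) *
        (((N : ℝ) + 1) ^ 2 - (x : ℝ) ^ 2)) := fun x =>
    .of_hasDerivAt fun u => ((hasDerivAt_exp_relRate N s u).add_const θ).mul_const _
  have := lap_nonpos (fun x hx => (hd x hx).sub (hE x)) (fun x hx => ?_) fun x hx u hu => ?_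
  · exact fun x hx u hu => sub_nonpos.1 (this x hx u hu)
  · simp only [sub_self, mul_zero, Real.exp_zero]
    nlinarith [h0 x hx, hh x hx]
  · rw [lap_sub_mul]
    have e := Real.exp_pos (-relRate N * (u - s))
    have h1 : relRate N * (((N : ℝ) + 1) ^ 2 - (x : ℝ) ^ 2) ≤ 1 := by
      nlinarith [relRate_mul N, mul_nonneg (relRate_nonneg N) (sq_nonneg (x : ℝ))]
    have h2 := mul_le_mul_of_nonneg_left (lap_parabola_le N x)
      (show 0 ≤ Real.exp (-relRate N * (u - s)) + θ by positivity)
    nlinarith [hF x hx u hu, mul_le_mul_of_nonneg_left h1 e.le]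

/-- Decay for the one-particle equation with bounded source. -/
theorem abs_le_barrier_of_lap {N : ℕ} {s θ : ℝ} {f F : ℤ → ℝ → ℝ} (hθ : 0 ≤ θ)
    (hd : ∀ x ∈ Finset.Icc (-(N : ℤ)) N,
      HasRightDerivFrom s (f x) (fun u => lap N (fun x => f x u) x + F x u))
    (hF : ∀ x ∈ Finset.Icc (-(N : ℤ)) N, ∀ u, s ≤ u → |F x u| ≤ θ)
    (h0 : ∀ x ∈ Finset.Icc (-(N : ℤ)) N, |f x s| ≤ 1) :
    ∀ x ∈ Finset.Icc (-(N : ℤ)) N, ∀ u, s ≤ u →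
      |f x u| ≤ (Real.exp (-relRate N * (u - s)) + θ) * (((N : ℝ) + 1) ^ 2 - (x : ℝ) ^ 2) := by
  intro x hx u hu
  refine abs_le'.2 ⟨?_, ?_⟩
  · exact le_barrier_of_lap hθ hd (fun x hx u hu => (le_abs_self _).trans (hF x hx u hu))
      (fun x hx => (le_abs_self _).trans (h0 x hx)) x hx u hu
  · exact le_barrier_of_lap (f := fun x u => -f x u) (F := fun x u => -F x u) hθ
      (fun x hx => (hd x hx).neg.congr_deriv fun u _ => by rw [lap_neg]; ring)
      (fun x hx u hu => (neg_le_abs _).trans (hF x hx u hu))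
      (fun x hx => (neg_le_abs _).trans (h0 x hx)) x hx u hu

/-! ### Heat equation on the bonds, for the density gradient. -/

/-- The barrier has three pieces. The first dominates the Dirichlet data. The constant `2 * κ` opens
a gap above these data, and half of this gap pays for the source `κ` on the two end bonds. The
parabola, whose second difference is `-2`, pays for the bulk source `κ / N` and for the time
derivative. -/
theorem le_barrier_of_heat {N : ℕ} (hN : 1 ≤ N) {κ : ℝ} (hκ : 0 ≤ κ) {g Γ : ℤ → ℝ → ℝ}
    (hd : ∀ x ∈ Finset.Icc (-(N : ℤ)) (N - 1), HasRightDerivFrom 0 (g x)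
      (fun u => (g (x + 1) u + g (x - 1) u - 2 * g x u) / 2 + Γ x u))
    (hΓ : ∀ x ∈ Finset.Icc (-(N : ℤ)) (N - 1), ∀ u, 0 ≤ u →
      Γ x u ≤ κ / N + if x = -N ∨ x = N - 1 then κ else 0)
    (hr : ∀ u, 0 ≤ u → g N u ≤ (Real.exp (-relRate N * (u - 0)) + 2 * κ) * (4 * N + 2))
    (hl : ∀ u, 0 ≤ u → g (-N - 1) u ≤ (Real.exp (-relRate N * (u - 0)) + 2 * κ) * (4 * N + 2))
    (h0 : ∀ x ∈ Finset.Icc (-(N : ℤ)) (N - 1), g x 0 ≤ 2) :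
    ∀ x ∈ Finset.Icc (-(N : ℤ)) (N - 1), ∀ u, 0 ≤ u →
      g x u ≤ (Real.exp (-relRate N * (u - 0)) + 2 * κ) * (4 * N + 2) + 2 * κ +
        (4 * Real.exp (-relRate N * (u - 0)) + κ / N) *
          (((N : ℝ) + 1) ^ 2 - (x : ℝ) * (x + 1)) := by
  have hN' : (1 : ℝ) ≤ N := by exact_mod_cast hN
  have hκN : 0 ≤ κ / N := by positivity
  have hq : ∀ x ∈ Finset.Icc (-(N : ℤ) - 1) N, (0 : ℝ) ≤ ((N : ℝ) + 1) ^ 2 - x * (x + 1) := by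
    intro x hx
    rw [Finset.mem_Icc] at hx
    have h1 : (-(N : ℝ)) - 1 ≤ x := by exact_mod_cast hx.1
    have h2 : (x : ℝ) ≤ N := by exact_mod_cast hx.2
    nlinarith
  have hq' : ∀ x : ℤ, (0 : ℝ) ≤ (x : ℝ) * (x + 1) := by
    intro x
    have : 0 ≤ x * (x + 1) := by
      rcases le_or_gt 0 x with h | h <;> nlinarith
    exact_mod_cast this
  set B : ℤ → ℝ → ℝ := fun x u =>
    (Real.exp (-relRate N * (u - 0)) + 2 * κ) * (4 * N + 2) + 2 * κ +
        (4 * Real.exp (-relRate N * (u - 0)) + κ / N) *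
          (((N : ℝ) + 1) ^ 2 - (x : ℝ) * (x + 1)) with hB
  have hBd : ∀ x, HasRightDerivFrom 0 (B x) (fun u =>
      -relRate N * Real.exp (-relRate N * (u - 0)) * (4 * N + 2) +
      4 * (-relRate N * Real.exp (-relRate N * (u - 0))) *
        (((N : ℝ) + 1) ^ 2 - (x : ℝ) * (x + 1))) := fun x =>
    .of_hasDerivAt fun u =>
      ((((hasDerivAt_exp_relRate N 0 u).add_const _).mul_const _).add_const _).add
        ((((hasDerivAt_exp_relRate N 0 u).const_mul 4).add_const _).mul_const _)
  have := nonpos_of_rightDeriv_le (C := 1) _ (fun x hx => ((hd x hx).sub (hBd x)).2)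
    (fun x hx => ((hd x hx).sub (hBd x)).1) (fun x hx => ?_) fun x hx u hu hpos => ?_
  · exact fun x hx u hu => sub_nonpos.1 (this x hx u hu)
  · have h1 := h0 x hx
    have h2 := hq x (by rw [Finset.mem_Icc] at hx ⊢; omega)
    simp only [hB, sub_self, mul_zero, Real.exp_zero]
    nlinarith [mul_nonneg hκN h2, mul_nonneg hκ (by linarith : (0 : ℝ) ≤ N)]
  · set σ := ∑ j ∈ Finset.Icc (-(N : ℤ)) (N - 1), max (g j u - B j u) 0 with hσ
    have e := Real.exp_pos (-relRate N * (u - 0))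
    have hs : 0 ≤ σ := Finset.sum_nonneg fun j _ => le_max_right _ _
    have key : ∀ z ∈ Finset.Icc (-(N : ℤ)) (N - 1), g z u ≤ B z u + σ := fun z hz => by
      have := (le_max_left (g z u - B z u) 0).trans
        (Finset.single_le_sum (f := fun j => max (g j u - B j u) 0)
          (fun j _ => le_max_right _ _) hz)
      linarith
    rw [Finset.mem_Icc] at hx
    -- At the last bond the right neighbour carries Dirichlet data, which lie at least `2 * κ` below
    -- the barrier.
    have hR : g (x + 1) u ≤ B (x + 1) u + σ - if x = N - 1 then 2 * κ else 0 := by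
      split_ifs with h
      · have h1 := hr u hu
        have h2 := hq N (by rw [Finset.mem_Icc]; omega)
        have h3 : x + 1 = N := by omega
        rw [h3]
        simp only [hB]
        have := mul_nonneg (show 0 ≤ 4 * Real.exp (-relRate N * (u - 0)) + κ / N by positivity) h2
        linarith
      · linarith [key (x + 1) (Finset.mem_Icc.2 (by omega))]
    have hL : g (x - 1) u ≤ B (x - 1) u + σ - if x = -N then 2 * κ else 0 := by
      split_ifs with h
      · have h1 := hl u hu
        have h2 := hq (-N - 1) (by rw [Finset.mem_Icc]; omega)
        rw [h]
        simp only [hB]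
        have := mul_nonneg (show 0 ≤ 4 * Real.exp (-relRate N * (u - 0)) + κ / N by positivity) h2
        linarith
      · linarith [key (x - 1) (Finset.mem_Icc.2 (by omega))]
    have hΓ' : Γ x u ≤ κ / N + ((if x = -N then 2 * κ else 0) + if x = N - 1 then 2 * κ else 0) / 2
        := by
      refine (hΓ x (Finset.mem_Icc.2 hx) u hu).trans ?_
      split_ifs <;> first | linarith | omega
    have hΔ : B (x + 1) u + B (x - 1) u - 2 * B x u =
        -2 * (4 * Real.exp (-relRate N * (u - 0)) + κ / N) := by
      simp only [hB]; push_cast; ring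
    -- The time derivative costs at most `2 + 4 * (1 / 2) = 4` times the exponential, exactly what
    -- the factor 4 of the parabola provides.
    have h1 : relRate N * (4 * N + 2) ≤ 2 := by
      have := relRate_mul N
      nlinarith [mul_nonneg (relRate_nonneg N) (by positivity : (0 : ℝ) ≤ (N : ℝ) ^ 2)]
    have h2 : relRate N * (((N : ℝ) + 1) ^ 2 - (x : ℝ) * (x + 1)) ≤ 1 / 2 := by
      nlinarith [relRate_mul N, mul_nonneg (relRate_nonneg N) (hq' x)]
    nlinarith [mul_le_mul_of_nonneg_left h1 e.le, mul_le_mul_of_nonneg_left h2 e.le]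

/-- Decay for the heat equation on the bonds with Dirichlet data. -/
theorem abs_le_barrier_of_heat {N : ℕ} (hN : 1 ≤ N) {κ : ℝ} (hκ : 0 ≤ κ) {g Γ : ℤ → ℝ → ℝ}
    (hd : ∀ x ∈ Finset.Icc (-(N : ℤ)) (N - 1), HasRightDerivFrom 0 (g x)
      (fun u => (g (x + 1) u + g (x - 1) u - 2 * g x u) / 2 + Γ x u))
    (hΓ : ∀ x ∈ Finset.Icc (-(N : ℤ)) (N - 1), ∀ u, 0 ≤ u →
      |Γ x u| ≤ κ / N + if x = -N ∨ x = N - 1 then κ else 0)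
    (hr : ∀ u, 0 ≤ u → |g N u| ≤ (Real.exp (-relRate N * (u - 0)) + 2 * κ) * (4 * N + 2))
    (hl : ∀ u, 0 ≤ u → |g (-N - 1) u| ≤ (Real.exp (-relRate N * (u - 0)) + 2 * κ) * (4 * N + 2))
    (h0 : ∀ x ∈ Finset.Icc (-(N : ℤ)) (N - 1), |g x 0| ≤ 2) :
    ∀ x ∈ Finset.Icc (-(N : ℤ)) (N - 1), ∀ u, 0 ≤ u →
      |g x u| ≤ (Real.exp (-relRate N * (u - 0)) + 2 * κ) * (4 * N + 2) + 2 * κ +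
        (4 * Real.exp (-relRate N * (u - 0)) + κ / N) *
          (((N : ℝ) + 1) ^ 2 - (x : ℝ) * (x + 1)) := by
  intro x hx u hu
  refine abs_le'.2 ⟨?_, ?_⟩
  · exact le_barrier_of_heat hN hκ hd (fun x hx u hu => (le_abs_self _).trans (hΓ x hx u hu))
      (fun u hu => (le_abs_self _).trans (hr u hu)) (fun u hu => (le_abs_self _).trans (hl u hu))
      (fun x hx => (le_abs_self _).trans (h0 x hx)) x hx u hu
  · exact le_barrier_of_heat (g := fun x u => -g x u) (Γ := fun x u => -Γ x u) hN hκ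
      (fun x hx => (hd x hx).neg.congr_deriv fun u _ => by ring)
      (fun x hx u hu => (neg_le_abs _).trans (hΓ x hx u hu))
      (fun u hu => (neg_le_abs _).trans (hr u hu)) (fun u hu => (neg_le_abs _).trans (hl u hu))
      (fun x hx => (neg_le_abs _).trans (h0 x hx)) x hx u hu

/-! ### Two killed exclusion particles: Green kernel and barriers. -/

/-- Positions of two exclusion particles. -/
noncomputable def pairs (N : ℕ) : Finset (ℤ × ℤ) :=
  ((Finset.Icc (-(N : ℤ)) N) ×ˢ (Finset.Icc (-(N : ℤ)) N)).filter fun p => p.1 < p.2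

theorem mem_pairs {N : ℕ} {p : ℤ × ℤ} : p ∈ pairs N ↔ -(N : ℤ) ≤ p.1 ∧ p.1 < p.2 ∧ p.2 ≤ N := by
  simp only [pairs, Finset.mem_filter, Finset.mem_product, Finset.mem_Icc]
  omega

/-- The Green kernel `(N + 1/2 + x) (N + 1/2 - y)`, up to normalization. -/
noncomputable def green (N : ℕ) (x y : ℤ) : ℝ := ((N : ℝ) + 1 / 2 + x) * ((N : ℝ) + 1 / 2 - y)

/-- Each factor is affine, hence harmonic in the bulk. The shift `1/2` makes it odd about the point
half a step beyond its end, which matches killing at rate 1. Only suppressing the two inward jumps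
of a neighbouring pair leaves a defect. -/
theorem lap₂_green (N : ℕ) (x y : ℤ) :
    lap₂ N (green N) x y = if y = x + 1 then -(N : ℝ) else 0 := by
  unfold lap₂ green
  split_ifs with h1 h2 h3 h3 h2 h3 h3 <;> (try subst h1) <;> (try subst h2) <;> (try subst h3) <;>
    push_cast <;> ring_nf
  -- What remains is a neighbouring pair with `y = N`, where the adjacency is an equation for `N`
  -- that cannot be substituted.
  all_goals
    have h : (N : ℝ) = _ := congrArg (Int.cast (R := ℝ)) h3
    push_cast at h
    nlinarith

theorem lap₂_parabola_le (N : ℕ) {x y : ℤ} (hx : -(N : ℤ) ≤ x) (hxy : x < y) (hy : y ≤ N) :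
    lap₂ N (fun x y => (((N : ℝ) + 1) ^ 2 - (x : ℝ) ^ 2) + (((N : ℝ) + 1) ^ 2 - (y : ℝ) ^ 2)) x y
      ≤ -2 := by
  have hN : (0 : ℝ) ≤ N := Nat.cast_nonneg N
  have hx' : (-(N : ℝ)) ≤ x := by exact_mod_cast hx
  have hy' : (y : ℝ) ≤ N := by exact_mod_cast hy
  have hxy' : (x : ℝ) ≤ y := by exact_mod_cast hxy.le
  unfold lap₂
  have h1 : (if x = -(N : ℤ) then
        -((((N : ℝ) + 1) ^ 2 - (x : ℝ) ^ 2) + (((N : ℝ) + 1) ^ 2 - (y : ℝ) ^ 2))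
      else ((((N : ℝ) + 1) ^ 2 - ((x - 1 : ℤ) : ℝ) ^ 2) + (((N : ℝ) + 1) ^ 2 - (y : ℝ) ^ 2) -
        ((((N : ℝ) + 1) ^ 2 - (x : ℝ) ^ 2) + (((N : ℝ) + 1) ^ 2 - (y : ℝ) ^ 2))) / 2) ≤
      (x : ℝ) - 1 / 2 := by
    split_ifs with h
    · have : (x : ℝ) = -N := by rw [h]; push_cast; ring
      rw [this] at hxy' ⊢
      nlinarith
    · push_cast
      linarith
  have h2 : (if y = (N : ℤ) then
        -((((N : ℝ) + 1) ^ 2 - (x : ℝ) ^ 2) + (((N : ℝ) + 1) ^ 2 - (y : ℝ) ^ 2))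
      else ((((N : ℝ) + 1) ^ 2 - (x : ℝ) ^ 2) + (((N : ℝ) + 1) ^ 2 - ((y + 1 : ℤ) : ℝ) ^ 2) -
        ((((N : ℝ) + 1) ^ 2 - (x : ℝ) ^ 2) + (((N : ℝ) + 1) ^ 2 - (y : ℝ) ^ 2))) / 2) ≤
      -(y : ℝ) - 1 / 2 := by
    split_ifs with h
    · have : (y : ℝ) = N := by rw [h]; push_cast; ring
      rw [this] at hxy' ⊢
      nlinarith
    · push_cast
      linarith
  -- The inward jumps contribute `y - x - 1`, which is zero for neighbours, so exclusion does not
  -- spoil the supersolution.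
  have h3 : (if y = x + 1 then 0 else
      ((((N : ℝ) + 1) ^ 2 - ((x + 1 : ℤ) : ℝ) ^ 2) + (((N : ℝ) + 1) ^ 2 - (y : ℝ) ^ 2) -
        ((((N : ℝ) + 1) ^ 2 - (x : ℝ) ^ 2) + (((N : ℝ) + 1) ^ 2 - (y : ℝ) ^ 2))) / 2 +
      ((((N : ℝ) + 1) ^ 2 - (x : ℝ) ^ 2) + (((N : ℝ) + 1) ^ 2 - ((y - 1 : ℤ) : ℝ) ^ 2) -
        ((((N : ℝ) + 1) ^ 2 - (x : ℝ) ^ 2) + (((N : ℝ) + 1) ^ 2 - (y : ℝ) ^ 2))) / 2) =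
      (y : ℝ) - x - 1 := by
    split_ifs with h
    · rw [h]; push_cast; ring
    · push_cast; ring
  linarith

theorem lap₂_nonpos {N : ℕ} {s : ℝ} {D D' : ℤ → ℤ → ℝ → ℝ}
    (hd : ∀ p ∈ pairs N, HasRightDerivFrom s (D p.1 p.2) (D' p.1 p.2))
    (h0 : ∀ p ∈ pairs N, D p.1 p.2 s ≤ 0)
    (hle : ∀ p ∈ pairs N, ∀ u, s ≤ u →
      D' p.1 p.2 u ≤ lap₂ N (fun x y => D x y u) p.1 p.2) :
    ∀ p ∈ pairs N, ∀ u, s ≤ u → D p.1 p.2 u ≤ 0 := by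
  refine nonpos_of_rightDeriv_le (C := 2) _ (fun p hp => (hd p hp).2) (fun p hp => (hd p hp).1) h0
    fun p hp u hu hpos => (hle p hp u hu).trans ?_
  obtain ⟨x, y⟩ := p
  have key : ∀ x y, (x, y) ∈ pairs N → D x y u ≤ ∑ p ∈ pairs N, max (D p.1 p.2 u) 0 :=
    fun x y hz => (le_max_left _ _).trans
      (Finset.single_le_sum (f := fun p : ℤ × ℤ => max (D p.1 p.2 u) 0)
        (fun j _ => le_max_right _ _) hz)
  have hs : 0 ≤ ∑ p ∈ pairs N, max (D p.1 p.2 u) 0 :=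
    Finset.sum_nonneg fun j _ => le_max_right _ _
  rw [mem_pairs] at hp
  simp only [mem_pairs] at key
  set σ := ∑ p ∈ pairs N, max (D p.1 p.2 u) 0
  simp only at hp hpos ⊢
  have h1 : (if x = -N then -D x y u else (D (x - 1) y u - D x y u) / 2) ≤ σ / 2 := by
    split_ifs with h
    · linarith
    · linarith [key (x - 1) y (by omega)]
  have h2 : (if y = N then -D x y u else (D x (y + 1) u - D x y u) / 2) ≤ σ / 2 := by
    split_ifs with h
    · linarith
    · linarith [key x (y + 1) (by omega)]
  have h3 : (if y = x + 1 then 0 else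
      (D (x + 1) y u - D x y u) / 2 + (D x (y - 1) u - D x y u) / 2) ≤ σ := by
    split_ifs with h
    · linarith
    · linarith [key x (y - 1) (by omega), key (x + 1) y (by omega)]
  unfold lap₂
  linarith

/-- The persistent source `A` on neighbouring pairs is absorbed by `green`, at cost `A / N * green`,
of order `A N`; the parabola alone would cost order `A N²`. The sum of parabolas handles the uniform
error `B`, the decaying source `A'` and the initial data. -/
theorem le_barrier_of_lap₂ {N : ℕ} (hN : 1 ≤ N) {A A' B : ℝ} (hA : 0 ≤ A) (hA' : 0 ≤ A')
    (hB : 0 ≤ B) {w R : ℤ → ℤ → ℝ → ℝ}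
    (hd : ∀ p ∈ pairs N, HasRightDerivFrom 0 (w p.1 p.2)
      (fun u => lap₂ N (fun x y => w x y u) p.1 p.2 + R p.1 p.2 u))
    (hR : ∀ p ∈ pairs N, ∀ u, 0 ≤ u → R p.1 p.2 u ≤
      (if p.2 = p.1 + 1 then A + A' * Real.exp (-relRate N * (u - 0)) else 0) + B)
    (h0 : ∀ p ∈ pairs N, w p.1 p.2 0 ≤ 1) :
    ∀ p ∈ pairs N, ∀ u, 0 ≤ u → w p.1 p.2 u ≤ A / N * green N p.1 p.2 +
      (B / 2 + (A' + 1) * Real.exp (-relRate N * (u - 0))) *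
        ((((N : ℝ) + 1) ^ 2 - (p.1 : ℝ) ^ 2) + (((N : ℝ) + 1) ^ 2 - (p.2 : ℝ) ^ 2)) := by
  have hN' : (1 : ℝ) ≤ N := by exact_mod_cast hN
  have hbd : ∀ p ∈ pairs N, (1 : ℝ) ≤
      (((N : ℝ) + 1) ^ 2 - (p.1 : ℝ) ^ 2) + (((N : ℝ) + 1) ^ 2 - (p.2 : ℝ) ^ 2) ∧
      0 ≤ green N p.1 p.2 := by
    intro p hp
    rw [mem_pairs] at hp
    have h1 : (-(N : ℝ)) ≤ p.1 := by exact_mod_cast hp.1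
    have h2 : (p.2 : ℝ) ≤ N := by exact_mod_cast hp.2.2
    have h3 : (p.1 : ℝ) ≤ p.2 := by exact_mod_cast hp.2.1.le
    constructor
    · nlinarith
    · unfold green
      exact mul_nonneg (by linarith) (by linarith)
  have hE : ∀ p : ℤ × ℤ, HasRightDerivFrom 0 (fun u => A / N * green N p.1 p.2 +
      (B / 2 + (A' + 1) * Real.exp (-relRate N * (u - 0))) *
        ((((N : ℝ) + 1) ^ 2 - (p.1 : ℝ) ^ 2) + (((N : ℝ) + 1) ^ 2 - (p.2 : ℝ) ^ 2)))
      (fun u => (A' + 1) * (-relRate N * Real.exp (-relRate N * (u - 0))) *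
        ((((N : ℝ) + 1) ^ 2 - (p.1 : ℝ) ^ 2) + (((N : ℝ) + 1) ^ 2 - (p.2 : ℝ) ^ 2))) := fun p =>
    .of_hasDerivAt fun u =>
      ((((hasDerivAt_exp_relRate N 0 u).const_mul (A' + 1)).const_add _).mul_const _).const_add _
  have := lap₂_nonpos (D := fun x y u => w x y u - (A / N * green N x y +
      (B / 2 + (A' + 1) * Real.exp (-relRate N * (u - 0))) *
        ((((N : ℝ) + 1) ^ 2 - (x : ℝ) ^ 2) + (((N : ℝ) + 1) ^ 2 - (y : ℝ) ^ 2))))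
      (D' := fun x y u => lap₂ N (fun x y => w x y u) x y + R x y u -
        (A' + 1) * (-relRate N * Real.exp (-relRate N * (u - 0))) *
        ((((N : ℝ) + 1) ^ 2 - (x : ℝ) ^ 2) + (((N : ℝ) + 1) ^ 2 - (y : ℝ) ^ 2)))
      (fun p hp => (hd p hp).sub (hE p)) (fun p hp => ?_) fun p hp u hu => ?_
  · exact fun x hx u hu => sub_nonpos.1 (this x hx u hu)
  · simp only [sub_self, mul_zero, Real.exp_zero]
    have h1 : 0 ≤ A / N * green N p.1 p.2 := mul_nonneg (by positivity) (hbd p hp).2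
    nlinarith [h0 p hp, (hbd p hp).1]
  · have hlin : lap₂ N (fun x y => w x y u - (A / N * green N x y +
      (B / 2 + (A' + 1) * Real.exp (-relRate N * (u - 0))) *
        ((((N : ℝ) + 1) ^ 2 - (x : ℝ) ^ 2) + (((N : ℝ) + 1) ^ 2 - (y : ℝ) ^ 2)))) p.1 p.2 =
        lap₂ N (fun x y => w x y u) p.1 p.2 - A / N * lap₂ N (green N) p.1 p.2 -
        (B / 2 + (A' + 1) * Real.exp (-relRate N * (u - 0))) * lap₂ N (fun x y =>
          (((N : ℝ) + 1) ^ 2 - (x : ℝ) ^ 2) + (((N : ℝ) + 1) ^ 2 - (y : ℝ) ^ 2)) p.1 p.2 := by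
      unfold lap₂; split_ifs <;> ring
    rw [hlin, lap₂_green]
    have e := Real.exp_pos (-relRate N * (u - 0))
    have h1 : relRate N *
        ((((N : ℝ) + 1) ^ 2 - (p.1 : ℝ) ^ 2) + (((N : ℝ) + 1) ^ 2 - (p.2 : ℝ) ^ 2)) ≤ 1 := by
      nlinarith [relRate_mul N, mul_nonneg (relRate_nonneg N) (sq_nonneg (p.1 : ℝ)),
        mul_nonneg (relRate_nonneg N) (sq_nonneg (p.2 : ℝ))]
    have h2 := mul_le_mul_of_nonneg_left (lap₂_parabola_le N (mem_pairs.1 hp).1 (mem_pairs.1 hp).2.1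
      (mem_pairs.1 hp).2.2)
      (show 0 ≤ B / 2 + (A' + 1) * Real.exp (-relRate N * (u - 0)) by positivity)
    have h3 := mul_le_mul_of_nonneg_left h1 (show 0 ≤ (A' + 1) *
      Real.exp (-relRate N * (u - 0)) by positivity)
    have h4 := hR p hp u hu
    have h5 : A / N * (if p.2 = p.1 + 1 then -(N : ℝ) else 0) = if p.2 = p.1 + 1 then -A else 0 := by
      split_ifs
      · field_simp
      · simp
    rw [h5]
    have h6 : (if p.2 = p.1 + 1 then A + A' * Real.exp (-relRate N * (u - 0)) else 0) ≤
        -(if p.2 = p.1 + 1 then -A else 0) + A' * Real.exp (-relRate N * (u - 0)) := by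
      split_ifs
      · linarith
      · have : 0 ≤ A' * Real.exp (-relRate N * (u - 0)) := by positivity
        linarith
    linarith

/-- Decay for the two-particle equation whose source is concentrated on neighbouring pairs, up to an
error `B`. -/
theorem abs_le_barrier_of_lap₂ {N : ℕ} (hN : 1 ≤ N) {A A' B : ℝ} (hA : 0 ≤ A) (hA' : 0 ≤ A')
    (hB : 0 ≤ B) {w R : ℤ → ℤ → ℝ → ℝ}
    (hd : ∀ p ∈ pairs N, HasRightDerivFrom 0 (w p.1 p.2)
      (fun u => lap₂ N (fun x y => w x y u) p.1 p.2 + R p.1 p.2 u))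
    (hR : ∀ p ∈ pairs N, ∀ u, 0 ≤ u → |R p.1 p.2 u| ≤
      (if p.2 = p.1 + 1 then A + A' * Real.exp (-relRate N * (u - 0)) else 0) + B)
    (h0 : ∀ p ∈ pairs N, |w p.1 p.2 0| ≤ 1) :
    ∀ p ∈ pairs N, ∀ u, 0 ≤ u → |w p.1 p.2 u| ≤ A / N * green N p.1 p.2 +
      (B / 2 + (A' + 1) * Real.exp (-relRate N * (u - 0))) *
        ((((N : ℝ) + 1) ^ 2 - (p.1 : ℝ) ^ 2) + (((N : ℝ) + 1) ^ 2 - (p.2 : ℝ) ^ 2)) := by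
  intro p hp u hu
  refine abs_le'.2 ⟨?_, ?_⟩
  · exact le_barrier_of_lap₂ hN hA hA' hB hd
      (fun p hp u hu => (le_abs_self _).trans (hR p hp u hu))
      (fun p hp => (le_abs_self _).trans (h0 p hp)) p hp u hu
  · exact le_barrier_of_lap₂ (w := fun x y u => -w x y u) (R := fun x y u => -R x y u) hN hA hA' hB
      (fun p hp => (hd p hp).neg.congr_deriv fun u _ => by rw [lap₂_neg]; ring)
      (fun p hp u hu => (neg_le_abs _).trans (hR p hp u hu))
      (fun p hp => (neg_le_abs _).trans (h0 p hp)) p hp u hu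

/-! ### Forward equation from the martingale problem. -/

section ForwardEquation

variable {N : ℕ} {Ω : Type*} [MeasurableSpace Ω] {X : ℝ≥0 → Ω → Config N}

/-- A process with right-continuous paths is jointly measurable. -/
theorem measurable_uncurry_of_rightCont (hm : ∀ t, StronglyMeasurable (X t))
    (hr : ∀ ω t, ContinuousWithinAt (fun u => X u ω) (Set.Ici t) t) :
    Measurable (fun p : ℝ × Ω => X p.1.toNNReal p.2) := by
  -- Countably valued times approaching `u` from the right, as right-continuity requires.
  set d : ℕ → ℝ → ℝ≥0 := fun n u => ((⌊u.toNNReal * (n + 1)⌋₊ + 1 : ℕ) : ℝ≥0) / (n + 1) with hd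
  have hdu : ∀ u, Tendsto (fun n => d n u) atTop (𝓝[≥] u.toNNReal) := by
    intro u
    have hle : ∀ n, u.toNNReal ≤ d n u := fun n => by
      rw [hd, le_div_iff₀ (by positivity)]
      push_cast
      exact (Nat.lt_floor_add_one _).le
    refine tendsto_nhdsWithin_iff.2 ⟨?_, Eventually.of_forall hle⟩
    refine tendsto_of_tendsto_of_tendsto_of_le_of_le tendsto_const_nhds
      (h := fun n : ℕ => u.toNNReal + 1 / ((n : ℝ≥0) + 1)) ?_ hle fun n => ?_
    · simpa using (tendsto_const_nhds (x := u.toNNReal)).add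
        (tendsto_one_div_add_atTop_nhds_zero_nat (𝕜 := ℝ≥0))
    · simp only [hd]
      rw [div_le_iff₀ (by positivity), add_mul, one_div, inv_mul_cancel₀ (by positivity)]
      push_cast
      gcongr
      exact Nat.floor_le zero_le
  have hmeas : ∀ n, Measurable fun p : ℝ × Ω => X (d n p.1) p.2 := by
    intro n
    have h1 : Measurable fun q : ℕ × Ω => X (((q.1 + 1 : ℕ) : ℝ≥0) / (n + 1)) q.2 :=
      measurable_from_prod_countable_right fun k => (hm (((k + 1 : ℕ) : ℝ≥0) / (n + 1))).measurable
    have h2 : Measurable fun p : ℝ × Ω => (⌊p.1.toNNReal * (n + 1)⌋₊, p.2) :=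
      (Nat.measurable_floor.comp
        ((measurable_real_toNNReal.comp measurable_fst).mul_const _)).prodMk measurable_snd
    exact h1.comp h2
  refine measurable_of_tendsto_metrizable hmeas (tendsto_pi_nhds.2 fun p => ?_)
  exact (hr p.2 p.1.toNNReal).tendsto.comp (hdu p.1)

theorem integral_mul_martingale_sub {P : Measure Ω} [IsFiniteMeasure P]
    {ℱ : Filtration ℝ≥0 ‹MeasurableSpace Ω›} {M : ℝ≥0 → Ω → ℝ} (hM : Martingale M ℱ P)
    {s t : ℝ≥0} (hst : s ≤ t) {Z : Ω → ℝ} (hZ : StronglyMeasurable[ℱ s] Z) {c : ℝ}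
    (hc : ∀ ω, |Z ω| ≤ c) : ∫ ω, Z ω * (M t ω - M s ω) ∂P = 0 := by
  have hint : ∀ r, Integrable (fun ω => Z ω * M r ω) P := fun r =>
    (hM.integrable r).bdd_mul (c := c) (hZ.mono (ℱ.le s)).aestronglyMeasurable
      (Eventually.of_forall hc)
  have h1 : P[Z * M t | ℱ s] =ᵐ[P] Z * M s :=
    (condExp_mul_of_stronglyMeasurable_left hZ (hint t) (hM.integrable t)).trans
      ((EventuallyEq.refl _ Z).mul (hM.condExp_ae_eq hst))
  have h2 : ∫ ω, Z ω * M t ω ∂P = ∫ ω, Z ω * M s ω ∂P := by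
    rw [show (fun ω => Z ω * M t ω) = Z * M t from rfl, ← integral_condExp (ℱ.le s),
      integral_congr_ae h1]
    rfl
  simp only [mul_sub]
  rw [integral_sub (hint t) (hint s), h2, sub_self]

/-- The generator with reservoir densities `a` and `b`. -/
noncomputable def genAt (a b : ℝ) (f : Config N → ℝ) (η : Config N) : ℝ :=
  genExc f η + genBdry a b f η

/-- The time dependence separates from the configuration: bounds, measurability and continuity in
time reduce to finitely many fixed observables with coefficients 1, `a`, `b`. -/
theorem genAt_affine (a b : ℝ) (f : Config N → ℝ) (η : Config N) :
    genAt a b f η = genAt 0 0 f η + a * (genAt 1 0 f η - genAt 0 0 f η) +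
      b * (genAt 0 1 f η - genAt 0 0 f η) := by
  unfold genAt genBdry flipRate
  split_ifs <;> ring

theorem exists_abs_le (f : Config N → ℝ) : ∃ c, ∀ η, |f η| ≤ c := by
  obtain ⟨c, hc⟩ := (Set.finite_range fun η => |f η|).bddAbove
  exact ⟨c, fun η => hc ⟨η, rfl⟩⟩

theorem exists_abs_genAt_le (f : Config N → ℝ) :
    ∃ c, ∀ a b : ℝ, |a| ≤ 1 → |b| ≤ 1 → ∀ η, |genAt a b f η| ≤ c := by
  obtain ⟨c₀, h₀⟩ := exists_abs_le fun η => genAt 0 0 f η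
  obtain ⟨c₁, h₁⟩ := exists_abs_le fun η => genAt 1 0 f η - genAt 0 0 f η
  obtain ⟨c₂, h₂⟩ := exists_abs_le fun η => genAt 0 1 f η - genAt 0 0 f η
  refine ⟨c₀ + 1 * c₁ + 1 * c₂, fun a b ha hb η => ?_⟩
  rw [genAt_affine]
  refine (abs_add_three _ _ _).trans ?_
  rw [abs_mul, abs_mul]
  gcongr
  exacts [h₀ η, h₁ η, h₂ η]

/-- `E(Z f(η_u))`. -/
noncomputable def weightedMean (P : Measure Ω) (X : ℝ≥0 → Ω → Config N) (Z : Ω → ℝ)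
    (f : Config N → ℝ) (u : ℝ) : ℝ :=
  ∫ ω, Z ω * f (X u.toNNReal ω) ∂P

variable {P : Measure Ω} {α : ℝ} {ρm ρp : ℝ → ℝ} {η₀ : Config N}
  {a b : ℝ → ℝ} {Z : Ω → ℝ} {c : ℝ}

theorem weightedMean_const_mul (k : ℝ) (f : Config N → ℝ) (u : ℝ) :
    weightedMean P X Z (fun η => k * f η) u = k * weightedMean P X Z f u := by
  unfold weightedMean
  rw [← integral_const_mul]
  exact integral_congr_ae (Eventually.of_forall fun ω => by simp only; ring)

theorem integrable_mul_comp [IsProbabilityMeasure P] (hm : ∀ t, StronglyMeasurable (X t))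
    (hZ : Measurable Z)
    (hc : ∀ ω, |Z ω| ≤ c) (f : Config N → ℝ) (t : ℝ≥0) :
    Integrable (fun ω => Z ω * f (X t ω)) P := by
  obtain ⟨k, hk⟩ := exists_abs_le f
  refine Integrable.of_bound
    (hZ.mul ((measurable_of_finite f).comp (hm t).measurable)).aestronglyMeasurable (c * k)
    (Eventually.of_forall fun ω => ?_)
  rw [norm_mul]
  exact mul_le_mul (hc ω) (hk _) (abs_nonneg _) ((abs_nonneg _).trans (hc ω))

theorem measurable_genAt (hX : IsExclusionProcess α ρm ρp η₀ P X) (ha : Continuous a)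
    (hb : Continuous b) (f : Config N → ℝ) :
    Measurable fun p : ℝ × Ω => genAt (a p.1) (b p.1) f (X p.1.toNNReal p.2) := by
  have hXm := measurable_uncurry_of_rightCont hX.measurable hX.rightCont
  have hcomp : ∀ g : Config N → ℝ, Measurable fun p : ℝ × Ω => g (X p.1.toNNReal p.2) :=
    fun g => (measurable_of_finite g).comp hXm
  simp only [fun p : ℝ × Ω => genAt_affine (a p.1) (b p.1) f (X p.1.toNNReal p.2)]
  exact ((hcomp fun η => genAt 0 0 f η).add ((ha.measurable.comp measurable_fst).mul
    (hcomp fun η => genAt 1 0 f η - genAt 0 0 f η))).add ((hb.measurable.comp measurable_fst).mul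
    (hcomp fun η => genAt 0 1 f η - genAt 0 0 f η))

theorem weightedMean_genAt [IsProbabilityMeasure P] (hm : ∀ t, StronglyMeasurable (X t))
    (hZ : Measurable Z)
    (hc : ∀ ω, |Z ω| ≤ c) (f : Config N → ℝ) (a b u : ℝ) :
    weightedMean P X Z (genAt a b f) u = weightedMean P X Z (genAt 0 0 f) u +
      a * weightedMean P X Z (fun η => genAt 1 0 f η - genAt 0 0 f η) u +
      b * weightedMean P X Z (fun η => genAt 0 1 f η - genAt 0 0 f η) u := by
  unfold weightedMean
  have hi := fun g : Config N → ℝ => integrable_mul_comp (P := P) hm hZ hc g u.toNNReal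
  have h : (fun ω => Z ω * genAt a b f (X u.toNNReal ω)) = fun ω =>
      Z ω * genAt 0 0 f (X u.toNNReal ω) +
        a * (Z ω * (genAt 1 0 f (X u.toNNReal ω) - genAt 0 0 f (X u.toNNReal ω))) +
        b * (Z ω * (genAt 0 1 f (X u.toNNReal ω) - genAt 0 0 f (X u.toNNReal ω))) := by
    funext ω
    rw [genAt_affine a b]
    ring
  have h₁ := (hi fun η => genAt 1 0 f η - genAt 0 0 f η).const_mul a
  have h₂ := (hi fun η => genAt 0 1 f η - genAt 0 0 f η).const_mul b
  have h₀₁ : Integrable (fun ω => Z ω * genAt 0 0 f (X u.toNNReal ω) +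
      a * (Z ω * (genAt 1 0 f (X u.toNNReal ω) - genAt 0 0 f (X u.toNNReal ω)))) P :=
    (hi (genAt 0 0 f)).add h₁
  rw [h, integral_add h₀₁ h₂, integral_add (hi (genAt 0 0 f)) h₁, integral_const_mul,
    integral_const_mul]

/-- A martingale increment after `s` is orthogonal to every bounded variable known at `s`; Fubini
then moves the expectation inside the time integral. The functions `a`, `b` need to agree with the
reservoir densities only at nonnegative times. -/
theorem weightedMean_sub [IsProbabilityMeasure P]
    (hX : IsExclusionProcess α ρm ρp η₀ P X) (ha : Continuous a)
    (hb : Continuous b) (ha1 : ∀ u, |a u| ≤ 1) (hb1 : ∀ u, |b u| ≤ 1)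
    (haρ : ∀ u, 0 ≤ u → ρm ((N : ℝ) ^ (-2 - α) * u) = a u)
    (hbρ : ∀ u, 0 ≤ u → ρp ((N : ℝ) ^ (-2 - α) * u) = b u)
    {s t : ℝ≥0} (hst : s ≤ t) (hZ : StronglyMeasurable[Filtration.natural X hX.measurable s] Z)
    (hc : ∀ ω, |Z ω| ≤ c) (f : Config N → ℝ) :
    weightedMean P X Z f t - weightedMean P X Z f s =
      ∫ u in (s : ℝ)..t, weightedMean P X Z (genAt (a u) (b u) f) u := by
  obtain ⟨k, hk⟩ := exists_abs_genAt_le f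
  have hst' : (s : ℝ) ≤ t := by exact_mod_cast hst
  have hZm : Measurable Z := (hZ.mono ((Filtration.natural X hX.measurable).le s)).measurable
  have hGm := measurable_genAt hX ha hb f
  have hpath : ∀ ω (r r' : ℝ), IntervalIntegrable
      (fun u => genAt (a u) (b u) f (X u.toNNReal ω)) volume r r' := fun ω r r' => by
    refine (intervalIntegrable_const (c := k)).mono_fun
      (hGm.comp measurable_prodMk_right).aestronglyMeasurable
      (Eventually.of_forall fun u => ?_)
    exact (hk _ _ (ha1 u) (hb1 u) _).trans (le_abs_self k)
  have hgen : ∀ ω (r : ℝ≥0), ∫ u in (0 : ℝ)..r, gen N α ρm ρp u f (X u.toNNReal ω) =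
      ∫ u in (0 : ℝ)..r, genAt (a u) (b u) f (X u.toNNReal ω) := fun ω r => by
    refine intervalIntegral.integral_congr fun u hu => ?_
    rw [Set.uIcc_of_le r.coe_nonneg] at hu
    simp only [gen, genAt, haρ u hu.1, hbρ u hu.1]
  have h0 := integral_mul_martingale_sub (hX.martingale f) hst hZ hc
  have hprod : Integrable (fun p : ℝ × Ω => Z p.2 * genAt (a p.1) (b p.1) f (X p.1.toNNReal p.2))
      ((volume.restrict (Set.Ioc (s : ℝ) t)).prod P) := by
    refine Integrable.of_bound ((hZm.comp measurable_snd).mul hGm).aestronglyMeasurable (c * k)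
      (Eventually.of_forall fun p => ?_)
    rw [norm_mul]
    exact mul_le_mul (hc _) (hk _ _ (ha1 _) (hb1 _) _) (abs_nonneg _)
      ((abs_nonneg _).trans (hc p.2))
  have hswap : ∫ u in (s : ℝ)..t, weightedMean P X Z (genAt (a u) (b u) f) u =
      ∫ ω, Z ω * (∫ u in (s : ℝ)..t, genAt (a u) (b u) f (X u.toNNReal ω)) ∂P := by
    rw [intervalIntegral.integral_of_le hst']
    unfold weightedMean
    rw [integral_integral_swap hprod]
    refine integral_congr_ae (Eventually.of_forall fun ω => ?_)
    simp only
    rw [intervalIntegral.integral_of_le hst', integral_const_mul]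
  have hint : Integrable (fun ω => Z ω * ∫ u in (s : ℝ)..t, genAt (a u) (b u) f (X u.toNNReal ω)) P
      := by
    refine hprod.integral_prod_right.congr (Eventually.of_forall fun ω => ?_)
    simp only
    rw [intervalIntegral.integral_of_le hst', integral_const_mul]
  have hi := fun r => integrable_mul_comp (P := P) hX.measurable hZm hc f r
  have hsplit : ∀ ω, Z ω * ((f (X t ω) - f (X 0 ω) -
      ∫ u in (0 : ℝ)..t, gen N α ρm ρp u f (X u.toNNReal ω)) - (f (X s ω) - f (X 0 ω) -
      ∫ u in (0 : ℝ)..s, gen N α ρm ρp u f (X u.toNNReal ω))) =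
      (Z ω * f (X t ω) - Z ω * f (X s ω)) -
        Z ω * ∫ u in (s : ℝ)..t, genAt (a u) (b u) f (X u.toNNReal ω) := fun ω => by
    rw [hgen, hgen, ← intervalIntegral.integral_interval_sub_left (hpath ω 0 t) (hpath ω 0 s)]
    ring
  simp only [hsplit] at h0
  have hts : Integrable (fun ω => Z ω * f (X t ω) - Z ω * f (X s ω)) P := (hi t).sub (hi s)
  rw [integral_sub hts hint, integral_sub (hi t) (hi s)] at h0
  rw [hswap]
  simp only [weightedMean, Real.toNNReal_coe]
  linarith

/-- Forward equation: `E(Z f(η_u))` has right derivative `E(Z L_u f(η_u))`. -/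
theorem hasRightDerivFrom_weightedMean [IsProbabilityMeasure P]
    (hX : IsExclusionProcess α ρm ρp η₀ P X) (ha : Continuous a)
    (hb : Continuous b) (ha1 : ∀ u, |a u| ≤ 1) (hb1 : ∀ u, |b u| ≤ 1)
    (haρ : ∀ u, 0 ≤ u → ρm ((N : ℝ) ^ (-2 - α) * u) = a u)
    (hbρ : ∀ u, 0 ≤ u → ρp ((N : ℝ) ^ (-2 - α) * u) = b u)
    {s : ℝ≥0} (hZ : StronglyMeasurable[Filtration.natural X hX.measurable s] Z)
    (hc : ∀ ω, |Z ω| ≤ c) (f : Config N → ℝ) :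
    HasRightDerivFrom s (weightedMean P X Z f)
      (fun u => weightedMean P X Z (genAt (a u) (b u) f) u) := by
  have hZm : Measurable Z := (hZ.mono ((Filtration.natural X hX.measurable).le s)).measurable
  have hid : ∀ (g : Config N → ℝ) (u v : ℝ), s ≤ u → u ≤ v →
      weightedMean P X Z g v - weightedMean P X Z g u =
        ∫ r in u..v, weightedMean P X Z (genAt (a r) (b r) g) r := by
    intro g u v hu huv
    lift u to ℝ≥0 using s.2.trans hu
    lift v to ℝ≥0 using u.2.trans huv
    exact weightedMean_sub hX ha hb ha1 hb1 haρ hbρ (by exact_mod_cast huv)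
      (hZ.mono ((Filtration.natural X hX.measurable).mono (by exact_mod_cast hu))) hc g
  -- The generator is bounded, so the integral identity makes every weighted mean Lipschitz. This
  -- feeds back into continuity of the integrand, which allows differentiation.
  have hcont : ∀ g : Config N → ℝ, ContinuousOn (weightedMean P X Z g) (Set.Ici s) := by
    intro g
    obtain ⟨k, hk⟩ := exists_abs_genAt_le g
    have hle : ∀ u v : ℝ, s ≤ u → u ≤ v →
        |weightedMean P X Z g v - weightedMean P X Z g u| ≤ (c * k) * |v - u| := by
      intro u v hu huv
      rw [hid g u v hu huv, ← Real.norm_eq_abs]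
      refine intervalIntegral.norm_integral_le_of_norm_le_const fun r _ => ?_
      have h := norm_integral_le_of_norm_le_const (μ := P) (C := c * k)
        (f := fun ω => Z ω * genAt (a r) (b r) g (X r.toNNReal ω))
        (Eventually.of_forall fun ω => ?_)
      · simpa [weightedMean] using h
      rw [norm_mul]
      exact mul_le_mul (hc _) (hk _ _ (ha1 _) (hb1 _) _) (abs_nonneg _)
        ((abs_nonneg _).trans (hc ω))
    refine (LipschitzOnWith.of_dist_le_mul (K := (c * k).toNNReal) fun u hu v hv => ?_).continuousOn
    have hck : c * k ≤ ((c * k).toNNReal : ℝ) := Real.le_coe_toNNReal _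
    rw [Real.dist_eq, Real.dist_eq]
    refine le_trans ?_ (mul_le_mul_of_nonneg_right hck (abs_nonneg _))
    rcases le_total u v with h | h
    · rw [abs_sub_comm, abs_sub_comm u]; exact hle u v hu h
    · exact hle v u hv h
  have hcontΦ : ContinuousOn (fun u => weightedMean P X Z (genAt (a u) (b u) f) u) (Set.Ici s) := by
    simp only [fun u => weightedMean_genAt (P := P) hX.measurable hZm hc f (a u) (b u) u]
    exact ((hcont _).add (ha.continuousOn.mul (hcont _))).add (hb.continuousOn.mul (hcont _))
  refine ⟨hcont f, fun u hu => ?_⟩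
  have hd := intervalIntegral.integral_hasDerivWithinAt_right (a := u) (b := u) (s := Set.Ici u)
    (t := Set.Ioi u) (f := fun u => weightedMean P X Z (genAt (a u) (b u) f) u)
    (by simp)
    ((hcontΦ.mono (Set.Ioi_subset_Ici hu)).stronglyMeasurableAtFilter_nhdsWithin
      measurableSet_Ioi u)
    ((hcontΦ u hu).mono (Set.Ioi_subset_Ici hu))
  refine (hd.const_add (weightedMean P X Z f u)).congr (fun v hv => ?_) (by simp)
  linarith [hid f u v hu hv]

end ForwardEquation

/-! ### Action of the generator on one and two occupation numbers. -/

section Generator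

variable {N : ℕ}

/-- The occupation number at an integer, zero outside the lattice. -/
noncomputable def occZ (x : ℤ) (η : Config N) : ℝ :=
  if h : -(N : ℤ) ≤ x ∧ x ≤ N then occ η ⟨x, h⟩ else 0

theorem occZ_coe (x : Site N) (η : Config N) : occZ (x : ℤ) η = occ η x := by
  rw [occZ, dif_pos x.2]

theorem occZ_mem (x : ℤ) (η : Config N) : 0 ≤ occZ x η ∧ occZ x η ≤ 1 := by
  unfold occZ occ
  split_ifs <;> norm_num

theorem occZ_exchange (p : ℤ) (η : Config N) (s t : Site N) :
    occZ p (exchange η s t) = occZ (Equiv.swap (s : ℤ) t p) η := by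
  by_cases hp : -(N : ℤ) ≤ p ∧ p ≤ N
  · have h : (Equiv.swap (s : ℤ) t p) = (Equiv.swap s t ⟨p, hp⟩ : Site N) := by
      simp only [Equiv.swap_apply_def, Subtype.ext_iff]
      split_ifs <;> rfl
    rw [h, occZ_coe, occZ, dif_pos hp]
    rfl
  · have h1 : p ≠ s := fun h => hp (h ▸ s.2)
    have h2 : p ≠ t := fun h => hp (h ▸ t.2)
    rw [Equiv.swap_apply_of_ne_of_ne h1 h2, occZ, occZ, dif_neg hp, dif_neg hp]

theorem occZ_flipAt (p : ℤ) (η : Config N) (s : Site N) :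
    occZ p (flipAt η s) = if p = s then 1 - occZ p η else occZ p η := by
  by_cases hp : -(N : ℤ) ≤ p ∧ p ≤ N
  · rw [occZ, dif_pos hp, occZ, dif_pos hp]
    unfold occ flipAt
    by_cases h : p = s
    · have h' : (⟨p, hp⟩ : Site N) = s := Subtype.ext h
      rw [if_pos h, h', Function.update_self]
      cases η s <;> simp
    · have h' : (⟨p, hp⟩ : Site N) ≠ s := fun h' => h (congrArg Subtype.val h')
      rw [if_neg h, Function.update_of_ne h']
  · have h1 : p ≠ s := fun h => hp (h ▸ s.2)
    rw [if_neg h1, occZ, occZ, dif_neg hp, dif_neg hp]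

theorem flipRate_mul (b : ℝ) (η : Config N) (s : Site N) :
    flipRate b η s * (1 - 2 * occZ (s : ℤ) η) = b - occZ (s : ℤ) η := by
  rw [occZ_coe, flipRate, occ]
  split_ifs <;> ring

theorem sum_bonds (T : ℤ → ℤ → ℝ) :
    (∑ x : Site N, ∑ y : Site N, if (y : ℤ) = (x : ℤ) + 1 then T x y else 0) =
      ∑ a ∈ Finset.Icc (-(N : ℤ)) (N - 1), T a (a + 1) := by
  have hs : ∀ G : ℤ → ℝ, ∑ x : Site N, G x = ∑ x ∈ Finset.Icc (-(N : ℤ)) N, G x := fun G =>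
    (Finset.sum_subtype _ (fun x => by simp) G).symm
  simp only [fun x : Site N => hs fun y => if y = (x : ℤ) + 1 then T x y else 0]
  rw [hs fun x => ∑ y ∈ Finset.Icc (-(N : ℤ)) N, if y = x + 1 then T x y else 0]
  simp only [Finset.sum_ite_eq']
  rw [← Finset.sum_filter]
  refine Finset.sum_congr ?_ fun _ _ => rfl
  ext x
  simp only [Finset.mem_filter, Finset.mem_Icc]
  omega

theorem genExc_occZ {x : ℤ} (hx : x ∈ Finset.Icc (-(N : ℤ)) N) (η : Config N) :
    genExc (occZ x) η = (if x = N then 0 else (occZ (x + 1) η - occZ x η) / 2) +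
      (if x = -N then 0 else (occZ (x - 1) η - occZ x η) / 2) := by
  rw [Finset.mem_Icc] at hx
  unfold genExc
  simp only [occZ_exchange]
  rw [sum_bonds fun s t => occZ (Equiv.swap s t x) η - occZ x η]
  have h : ∀ a : ℤ, occZ (Equiv.swap a (a + 1) x) η - occZ x η =
      (if a = x then occZ (x + 1) η - occZ x η else 0) +
        (if a = x - 1 then occZ (x - 1) η - occZ x η else 0) := by
    intro a
    have n1 : ∀ z : ℤ, z ≠ z - 1 := fun z => by omega
    rw [Equiv.swap_apply_def]
    by_cases h1 : a = x
    · subst h1; simp [n1]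
    · by_cases h2 : a = x - 1
      · subst h2; simp [n1]
      · rw [if_neg (Ne.symm h1), if_neg (by omega), if_neg h1, if_neg h2]; simp
  simp only [h, Finset.sum_add_distrib, Finset.sum_ite_eq', Finset.mem_Icc]
  split_ifs <;> first | omega | ring

/-- Only bonds touching `x` or `y` matter. For neighbours the bond between them merely permutes the
two factors, whence the suppressed inward jumps in `lap₂`. -/
theorem genExc_occZ_mul {x y : ℤ} (hx : -(N : ℤ) ≤ x) (hxy : x < y) (hy : y ≤ N) (η : Config N) :
    genExc (fun η => occZ x η * occZ y η) η =
      (if x = -N then 0 else (occZ (x - 1) η * occZ y η - occZ x η * occZ y η) / 2) +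
      (if y = N then 0 else (occZ x η * occZ (y + 1) η - occZ x η * occZ y η) / 2) +
      (if y = x + 1 then 0 else (occZ (x + 1) η * occZ y η - occZ x η * occZ y η) / 2 +
        (occZ x η * occZ (y - 1) η - occZ x η * occZ y η) / 2) := by
  unfold genExc
  simp only [occZ_exchange]
  rw [sum_bonds fun s t => occZ (Equiv.swap s t x) η * occZ (Equiv.swap s t y) η -
    occZ x η * occZ y η]
  have h : ∀ a : ℤ, occZ (Equiv.swap a (a + 1) x) η * occZ (Equiv.swap a (a + 1) y) η -
      occZ x η * occZ y η =
      (if a = x - 1 then occZ (x - 1) η * occZ y η - occZ x η * occZ y η else 0) +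
      (if a = y then occZ x η * occZ (y + 1) η - occZ x η * occZ y η else 0) +
      ((if a = x then
        if y = x + 1 then 0 else occZ (x + 1) η * occZ y η - occZ x η * occZ y η else 0) +
      (if a = y - 1 then
        if y = x + 1 then 0 else occZ x η * occZ (y - 1) η - occZ x η * occZ y η else 0)) := by
    intro a
    have n1 : ∀ z : ℤ, z ≠ z - 1 := fun z => by omega
    simp only [Equiv.swap_apply_def]
    by_cases h1 : a = x - 1
    · subst h1
      have e2 : y ≠ x - 1 := by omega
      simp [n1, e2, e2.symm, hxy.ne, hxy.ne']
    · by_cases h2 : a = y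
      · subst h2
        have e1 : x ≠ a + 1 := by omega
        simp [n1, e1, hxy.ne, hxy.ne', h1]
      · by_cases h3 : y = x + 1
        · subst h3
          by_cases h4 : a = x
          · subst h4; simp [n1, mul_comm]
          · have e1 : x ≠ a + 1 := by omega
            simp [h1, h2, h4, Ne.symm h4, Ne.symm h2, e1]
        · by_cases h4 : a = x
          · subst h4
            have e1 : a ≠ y - 1 := by omega
            simp [n1, h3, e1, h2, Ne.symm h2]
          · by_cases h5 : a = y - 1
            · subst h5
              have e1 : x ≠ y - 1 := by omega
              simp [n1, h3, hxy.ne, h4, e1, h1]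
            · have e1 : x ≠ a + 1 := by omega
              have e2 : y ≠ a + 1 := by omega
              simp [h1, h2, h4, h5, Ne.symm h4, Ne.symm h2, e1, e2]
  simp only [h, Finset.sum_add_distrib, Finset.sum_ite_eq', Finset.mem_Icc]
  split_ifs <;> first | omega | ring

/-- A reservoir of density `b` acts on its site by `b - η`: killing at rate 1 plus a constant source
(`flipRate_mul`). With `1 ≤ N` the two end sites differ. -/
theorem genAt_occZ (hN : 1 ≤ N) (a b : ℝ) {x : ℤ} (hx : x ∈ Finset.Icc (-(N : ℤ)) N)
    (η : Config N) : genAt a b (occZ x) η = lap N (fun z => occZ z η) x +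
      ((if x = N then b else 0) + if x = -N then a else 0) := by
  have hr := flipRate_mul b η (rightEnd N)
  have hl := flipRate_mul a η (leftEnd N)
  have er : ((rightEnd N : Site N) : ℤ) = N := rfl
  have el : ((leftEnd N : Site N) : ℤ) = -N := rfl
  rw [er] at hr
  rw [el] at hl
  rw [genAt, genExc_occZ hx, genBdry, occZ_flipAt, occZ_flipAt, er, el, lap]
  split_ifs with h1 h2 h2
  · omega
  · subst h1; linear_combination hr
  · subst h2; linear_combination hl
  · ring

theorem genAt_occZ_mul (a b : ℝ) {x y : ℤ} (hx : -(N : ℤ) ≤ x) (hxy : x < y) (hy : y ≤ N)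
    (η : Config N) : genAt a b (fun η => occZ x η * occZ y η) η =
      lap₂ N (fun x y => occZ x η * occZ y η) x y +
      ((if y = N then b * occZ x η else 0) + if x = -N then a * occZ y η else 0) := by
  have hr := flipRate_mul b η (rightEnd N)
  have hl := flipRate_mul a η (leftEnd N)
  have er : ((rightEnd N : Site N) : ℤ) = N := rfl
  have el : ((leftEnd N : Site N) : ℤ) = -N := rfl
  rw [er] at hr
  rw [el] at hl
  have hxN : x ≠ N := by omega
  have hyN : y ≠ -N := by omega
  rw [genAt, genExc_occZ_mul hx hxy hy, genBdry, lap₂]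
  simp only [occZ_flipAt, er, el, hxN, hyN, if_false]
  have hR : flipRate b η (rightEnd N) *
      ((occZ x η * if y = N then 1 - occZ y η else occZ y η) - occZ x η * occZ y η) =
      if y = N then occZ x η * (b - occZ y η) else 0 := by
    split_ifs with h
    · rw [h]; linear_combination occZ x η * hr
    · ring
  have hL : flipRate a η (leftEnd N) *
      ((if x = -N then 1 - occZ x η else occZ x η) * occZ y η - occZ x η * occZ y η) =
      if x = -N then (a - occZ x η) * occZ y η else 0 := by
    split_ifs with h
    · rw [h]; linear_combination occZ y η * hl
    · ring
  rw [hR, hL]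
  split_ifs <;> ring

end Generator

/-! ### Closed equations for the weighted first and second moments. -/

section Moments

variable {N : ℕ} {Ω : Type*} [MeasurableSpace Ω] {X : ℝ≥0 → Ω → Config N} {P : Measure Ω}
  [IsProbabilityMeasure P] {α : ℝ} {ρm ρp : ℝ → ℝ} {η₀ : Config N} {a b : ℝ → ℝ} {Z : Ω → ℝ} {c : ℝ}

theorem weightedMean_add (hm : ∀ t, StronglyMeasurable (X t)) (hZ : Measurable Z)
    (hc : ∀ ω, |Z ω| ≤ c) (f g : Config N → ℝ) (u : ℝ) :
    weightedMean P X Z (fun η => f η + g η) u =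
      weightedMean P X Z f u + weightedMean P X Z g u := by
  unfold weightedMean
  simp only [mul_add]
  exact integral_add (integrable_mul_comp hm hZ hc f _) (integrable_mul_comp hm hZ hc g _)

theorem weightedMean_lap (hm : ∀ t, StronglyMeasurable (X t)) (hZ : Measurable Z)
    (hc : ∀ ω, |Z ω| ≤ c) (f : ℤ → Config N → ℝ) (x : ℤ) (u : ℝ) :
    weightedMean P X Z (fun η => lap N (fun z => f z η) x) u =
      lap N (fun z => weightedMean P X Z (f z) u) x := by
  have hneg : ∀ z, weightedMean P X Z (fun η => -f z η) u = -weightedMean P X Z (f z) u := fun z =>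
    by simpa using weightedMean_const_mul (P := P) (X := X) (Z := Z) (-1) (f z) u
  have hdiff : ∀ z z', weightedMean P X Z (fun η => (f z η - f z' η) / 2) u =
      (weightedMean P X Z (f z) u - weightedMean P X Z (f z') u) / 2 := fun z z' => by
    have : (fun η => (f z η - f z' η) / 2) = fun η => 1 / 2 * f z η + -1 / 2 * f z' η := by
      funext η; ring
    rw [this, weightedMean_add hm hZ hc, weightedMean_const_mul, weightedMean_const_mul]
    ring
  unfold lap
  split_ifs <;> rw [weightedMean_add hm hZ hc] <;> simp only [hneg, hdiff]

theorem weightedMean_lap₂ (hm : ∀ t, StronglyMeasurable (X t)) (hZ : Measurable Z)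
    (hc : ∀ ω, |Z ω| ≤ c) (f : ℤ → ℤ → Config N → ℝ) (x y : ℤ) (u : ℝ) :
    weightedMean P X Z (fun η => lap₂ N (fun z z' => f z z' η) x y) u =
      lap₂ N (fun z z' => weightedMean P X Z (f z z') u) x y := by
  have hneg : ∀ z z', weightedMean P X Z (fun η => -f z z' η) u =
      -weightedMean P X Z (f z z') u := fun z z' => by
    simpa using weightedMean_const_mul (P := P) (X := X) (Z := Z) (-1) (f z z') u
  have hzero : weightedMean P X Z (fun _ => (0 : ℝ)) u = 0 := by simp [weightedMean]
  have hdiff : ∀ z w z' w', weightedMean P X Z (fun η => (f z w η - f z' w' η) / 2) u =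
      (weightedMean P X Z (f z w) u - weightedMean P X Z (f z' w') u) / 2 := fun z w z' w' => by
    have : (fun η => (f z w η - f z' w' η) / 2) =
        fun η => 1 / 2 * f z w η + -1 / 2 * f z' w' η := by
      funext η; ring
    rw [this, weightedMean_add hm hZ hc, weightedMean_const_mul, weightedMean_const_mul]
    ring
  unfold lap₂
  split_ifs <;> simp only [weightedMean_add hm hZ hc, hneg, hdiff, hzero]

/-- The first moments solve the one-particle equation. -/
theorem hasRightDerivFrom_occZ (hN : 1 ≤ N) (hX : IsExclusionProcess α ρm ρp η₀ P X)
    (ha : Continuous a) (hb : Continuous b) (ha1 : ∀ u, |a u| ≤ 1) (hb1 : ∀ u, |b u| ≤ 1)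
    (haρ : ∀ u, 0 ≤ u → ρm ((N : ℝ) ^ (-2 - α) * u) = a u)
    (hbρ : ∀ u, 0 ≤ u → ρp ((N : ℝ) ^ (-2 - α) * u) = b u)
    {s : ℝ≥0} (hZ : StronglyMeasurable[Filtration.natural X hX.measurable s] Z)
    (hc : ∀ ω, |Z ω| ≤ c) {x : ℤ} (hx : x ∈ Finset.Icc (-(N : ℤ)) N) :
    HasRightDerivFrom s (weightedMean P X Z (occZ x)) (fun u =>
      lap N (fun z => weightedMean P X Z (occZ z) u) x +
        ((if x = N then b u else 0) + if x = -N then a u else 0) * ∫ ω, Z ω ∂P) := by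
  have hZm : Measurable Z := (hZ.mono ((Filtration.natural X hX.measurable).le s)).measurable
  refine (hasRightDerivFrom_weightedMean hX ha hb ha1 hb1 haρ hbρ hZ hc (occZ x)).congr_deriv
    fun u _ => ?_
  have h : genAt (a u) (b u) (occZ x) = fun η : Config N => lap N (fun z => occZ z η) x +
      ((if x = N then b u else 0) + if x = -N then a u else 0) * 1 := by
    funext η
    rw [genAt_occZ hN _ _ hx, mul_one]
  rw [h, weightedMean_add hX.measurable hZm hc, weightedMean_lap hX.measurable hZm hc,
    weightedMean_const_mul]
  simp [weightedMean]

/-- The second moments solve the two-particle equation. -/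
theorem hasRightDerivFrom_occZ_mul (hX : IsExclusionProcess α ρm ρp η₀ P X)
    (ha : Continuous a) (hb : Continuous b) (ha1 : ∀ u, |a u| ≤ 1) (hb1 : ∀ u, |b u| ≤ 1)
    (haρ : ∀ u, 0 ≤ u → ρm ((N : ℝ) ^ (-2 - α) * u) = a u)
    (hbρ : ∀ u, 0 ≤ u → ρp ((N : ℝ) ^ (-2 - α) * u) = b u)
    {s : ℝ≥0} (hZ : StronglyMeasurable[Filtration.natural X hX.measurable s] Z)
    (hc : ∀ ω, |Z ω| ≤ c) {x y : ℤ} (hx : -(N : ℤ) ≤ x) (hxy : x < y) (hy : y ≤ N) :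
    HasRightDerivFrom s (weightedMean P X Z (fun η => occZ x η * occZ y η)) (fun u =>
      lap₂ N (fun z z' => weightedMean P X Z (fun η => occZ z η * occZ z' η) u) x y +
        ((if y = N then b u * weightedMean P X Z (occZ x) u else 0) +
          if x = -N then a u * weightedMean P X Z (occZ y) u else 0)) := by
  have hZm : Measurable Z := (hZ.mono ((Filtration.natural X hX.measurable).le s)).measurable
  refine (hasRightDerivFrom_weightedMean hX ha hb ha1 hb1 haρ hbρ hZ hc _).congr_deriv
    fun u _ => ?_
  have h : genAt (a u) (b u) (fun η : Config N => occZ x η * occZ y η) = fun η : Config N =>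
      lap₂ N (fun x y => occZ x η * occZ y η) x y +
      ((if y = N then b u else 0) * occZ x η + (if x = -N then a u else 0) * occZ y η) := by
    funext η
    rw [genAt_occZ_mul _ _ hx hxy hy]
    split_ifs <;> ring
  rw [h, weightedMean_add hX.measurable hZm hc, weightedMean_add hX.measurable hZm hc,
    weightedMean_lap₂ hX.measurable hZm hc, weightedMean_const_mul, weightedMean_const_mul]
  split_ifs <;> ring

end Moments

/-! ### Smoothing the reservoir densities in time. -/

section Average

/-- The average of `a` over `[u, u + 1]`. -/
noncomputable def average (a : ℝ → ℝ) (u : ℝ) : ℝ := ∫ r in u..(u + 1), a r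

variable {a : ℝ → ℝ} {κ : ℝ}

/-- A Lipschitz density need not be differentiable. Its unit-time average is, and for Lipschitz
constant `κ` both the derivative and the averaging error are at most `κ`. -/
theorem hasDerivAt_average (ha : Continuous a) (u : ℝ) :
    HasDerivAt (average a) (a (u + 1) - a u) u := by
  have hi : ∀ x y, IntervalIntegrable a volume x y := ha.intervalIntegrable
  have h : average a = fun u => (∫ r in (0 : ℝ)..(u + 1), a r) - ∫ r in (0 : ℝ)..u, a r := by
    funext v
    rw [average, intervalIntegral.integral_interval_sub_left (hi _ _) (hi _ _)]
  have h0 : ∀ v, HasDerivAt (fun v => ∫ r in (0 : ℝ)..v, a r) (a v) v := fun v =>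
    intervalIntegral.integral_hasDerivAt_right (hi _ _) (ha.stronglyMeasurableAtFilter _ _)
      ha.continuousAt
  rw [h]
  exact ((h0 (u + 1)).comp_add_const u 1).sub (h0 u)

theorem average_mem (ha : Continuous a) (h01 : ∀ u, a u ∈ Set.Icc (0 : ℝ) 1) (u : ℝ) :
    average a u ∈ Set.Icc (0 : ℝ) 1 := by
  have hle : u ≤ u + 1 := by linarith
  constructor
  · exact intervalIntegral.integral_nonneg hle fun r _ => (h01 r).1
  · have := intervalIntegral.integral_mono_on (μ := volume) hle (ha.intervalIntegrable _ _)
      (intervalIntegrable_const (c := (1 : ℝ))) fun r _ => (h01 r).2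
    simpa [average] using this

theorem abs_sub_average_le (ha : Continuous a) (hL : ∀ u v, |a u - a v| ≤ κ * |u - v|) (u : ℝ) :
    |a u - average a u| ≤ κ := by
  have hκ : 0 ≤ κ := by simpa using (abs_nonneg _).trans (hL 1 0)
  have h : a u - average a u = ∫ r in u..(u + 1), (a u - a r) := by
    rw [intervalIntegral.integral_sub intervalIntegrable_const (ha.intervalIntegrable _ _)]
    simp [average]
  rw [h, ← Real.norm_eq_abs]
  have := intervalIntegral.norm_integral_le_of_norm_le_const (a := u) (b := u + 1) (C := κ)
    (f := fun r => a u - a r) fun r hr => ?_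
  · simpa using this
  · rw [Set.uIoc_of_le (by linarith)] at hr
    refine (hL u r).trans ?_
    have : |u - r| ≤ 1 := abs_le.2 ⟨by linarith [hr.2], by linarith [hr.1]⟩
    nlinarith

end Average

/-! ### Stationary profile and odd reflection. -/

section Profile

/-- The stationary density profile for reservoir densities `a`, `b`. -/
noncomputable def profile (N : ℕ) (a b : ℝ) (x : ℤ) : ℝ := (a + b) / 2 + (b - a) / (2 * N + 1) * x

variable {N : ℕ}

/-- The profile interpolates linearly between `a` at `-N - 1/2` and `b` at `N + 1/2`, whence the
denominator `2 * N + 1`. -/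
theorem lap_profile (hN : 1 ≤ N) (a b : ℝ) (x : ℤ) :
    lap N (profile N a b) x = -((if x = N then b else 0) + if x = -N then a else 0) := by
  have h : (2 * (N : ℝ) + 1) ≠ 0 := by positivity
  unfold lap profile
  split_ifs with h1 h2 h2
  · omega
  · subst h1; push_cast; field_simp; ring
  · subst h2; push_cast; field_simp; ring
  · push_cast; ring

theorem profile_mem {lo hi a b : ℝ} (ha : a ∈ Set.Icc lo hi) (hb : b ∈ Set.Icc lo hi) {x : ℤ}
    (hx : x ∈ Finset.Icc (-(N : ℤ)) N) : profile N a b x ∈ Set.Icc lo hi := by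
  have hn : (0 : ℝ) < 2 * N + 1 := by positivity
  rw [Finset.mem_Icc] at hx
  have h1 : (-(N : ℝ)) ≤ x := by exact_mod_cast hx.1
  have h2 : (x : ℝ) ≤ N := by exact_mod_cast hx.2
  set q := (x : ℝ) / (2 * N + 1) with hq
  have hq1 : -(1 / 2) ≤ q := by rw [hq, le_div_iff₀ hn]; linarith
  have hq2 : q ≤ 1 / 2 := by rw [hq, div_le_iff₀ hn]; linarith
  have he : profile N a b x = a * (1 / 2 - q) + b * (1 / 2 + q) := by
    rw [profile, hq]; field_simp; ring
  rw [he]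
  have e1 : 0 ≤ 1 / 2 - q := by linarith
  have e2 : 0 ≤ 1 / 2 + q := by linarith
  constructor
  · nlinarith [mul_le_mul_of_nonneg_right ha.1 e1, mul_le_mul_of_nonneg_right hb.1 e2]
  · nlinarith [mul_le_mul_of_nonneg_right ha.2 e1, mul_le_mul_of_nonneg_right hb.2 e2]

/-- Extension by odd reflection at the end points. -/
noncomputable def oddExt (N : ℕ) (f : ℤ → ℝ) (x : ℤ) : ℝ :=
  if x = N + 1 then -f N else if x = -N - 1 then -f (-N) else f x

theorem oddExt_of_mem (f : ℤ → ℝ) {x : ℤ} (hx : x ∈ Finset.Icc (-(N : ℤ)) N) :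
    oddExt N f x = f x := by
  rw [Finset.mem_Icc] at hx
  rw [oddExt, if_neg (by omega), if_neg (by omega)]

/-- Killing at rate 1 is a jump at rate `1/2` to a ghost site carrying the opposite value. The
operator thus becomes translation invariant, and differences solve a plain heat equation. -/
theorem lap_eq_oddExt (f : ℤ → ℝ) {x : ℤ} (hx : x ∈ Finset.Icc (-(N : ℤ)) N) :
    lap N f x = (oddExt N f (x + 1) + oddExt N f (x - 1) - 2 * oddExt N f x) / 2 := by
  rw [oddExt_of_mem f hx]
  rw [Finset.mem_Icc] at hx
  have h1 : oddExt N f (x + 1) = if x = N then -f x else f (x + 1) := by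
    unfold oddExt
    split_ifs with h1 h2 h2 h3 h3 <;> first | omega | rfl | (subst h2; rfl)
  have h2 : oddExt N f (x - 1) = if x = -N then -f x else f (x - 1) := by
    unfold oddExt
    split_ifs with h1 h2 h2 h3 h3 <;> first | omega | rfl | (subst h3; rfl)
  rw [h1, h2, lap]
  split_ifs <;> ring

end Profile

/-! ### Relaxation of the density gradient. -/

section Deterministic

variable {N : ℕ} {κ : ℝ} {a b : ℝ → ℝ} {r : ℤ → ℝ → ℝ} {p : ℤ → ℤ → ℝ → ℝ}

theorem two_div_le (hN : 1 ≤ N) (hκ : 0 ≤ κ) : 2 * κ / (2 * N + 1) ≤ κ / N := by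
  have hN' : (1 : ℝ) ≤ N := by exact_mod_cast hN
  rw [div_le_div_iff₀ (by positivity) (by positivity)]
  nlinarith

theorem profile_sub (N : ℕ) (a b : ℝ) (x : ℤ) :
    profile N a b (x + 1) - profile N a b x = (b - a) / (2 * N + 1) := by
  unfold profile; push_cast; ring

/-- The density gradient relaxes to the quasi-stationary gradient. -/
theorem abs_grad_sub_le (hN : 1 ≤ N) (ha : Continuous a) (hb : Continuous b)
    (ha01 : ∀ u, a u ∈ Set.Icc (0 : ℝ) 1) (hb01 : ∀ u, b u ∈ Set.Icc (0 : ℝ) 1)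
    (haL : ∀ u v, |a u - a v| ≤ κ * |u - v|) (hbL : ∀ u v, |b u - b v| ≤ κ * |u - v|)
    (hr : ∀ x ∈ Finset.Icc (-(N : ℤ)) N, HasRightDerivFrom 0 (r x) (fun u =>
      lap N (fun z => r z u) x + ((if x = N then b u else 0) + if x = -N then a u else 0)))
    (hr01 : ∀ x u, r x u ∈ Set.Icc (0 : ℝ) 1) :
    ∀ x ∈ Finset.Icc (-(N : ℤ)) (N - 1), ∀ u, 0 ≤ u →
      |r (x + 1) u - r x u - (average b u - average a u) / (2 * N + 1)| ≤
        22 * N ^ 2 * Real.exp (-relRate N * (u - 0)) + 18 * κ * N := by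
  have hκ : 0 ≤ κ := by simpa using (abs_nonneg _).trans (haL 1 0)
  have hN' : (1 : ℝ) ≤ N := by exact_mod_cast hN
  set δ : ℤ → ℝ → ℝ := fun x u => r x u - profile N (average a u) (average b u) x with hδ
  -- Error source for the deviation `δ`: the averaging error at the ends and the time derivative of
  -- the moving profile.
  set F : ℤ → ℝ → ℝ := fun x u =>
    ((if x = N then b u - average b u else 0) + if x = -N then a u - average a u else 0) -
      profile N (a (u + 1) - a u) (b (u + 1) - b u) x with hF
  have hstep : ∀ c : ℝ → ℝ, (∀ u v, |c u - c v| ≤ κ * |u - v|) → ∀ u, c (u + 1) - c u ∈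
      Set.Icc (-κ) κ := fun c hc u => by
    have := hc (u + 1) u
    rw [add_sub_cancel_left, abs_one, mul_one] at this
    exact abs_le.1 this
  have hδd : ∀ x ∈ Finset.Icc (-(N : ℤ)) N, HasRightDerivFrom 0 (δ x)
      (fun u => lap N (fun z => δ z u) x + F x u) := by
    intro x hx
    have hp : HasRightDerivFrom 0 (fun u => profile N (average a u) (average b u) x)
        (fun u => profile N (a (u + 1) - a u) (b (u + 1) - b u) x) :=
      .of_hasDerivAt fun u =>
        (((hasDerivAt_average ha u).add (hasDerivAt_average hb u)).div_const 2).add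
          ((((hasDerivAt_average hb u).sub (hasDerivAt_average ha u)).div_const _).mul_const _)
    refine ((hr x hx).sub hp).congr_deriv fun u _ => ?_
    have h1 := lap_sub_mul N (fun z => r z u) (profile N (average a u) (average b u)) 1 x
    simp only [one_mul] at h1
    simp only [hδ, hF]
    rw [h1, lap_profile hN]
    split_ifs <;> ring
  have hFb : ∀ x ∈ Finset.Icc (-(N : ℤ)) N, ∀ u, 0 ≤ u → |F x u| ≤ 2 * κ := by
    intro x hx u _
    have h1 := abs_le.1 (abs_sub_average_le ha haL u)
    have h2 := abs_le.1 (abs_sub_average_le hb hbL u)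
    have h3 := profile_mem (hstep a haL u) (hstep b hbL u) hx
    simp only [hF]
    rw [abs_le]
    split_ifs with h4 h5 h5
    · omega
    all_goals constructor <;> linarith [h3.1, h3.2]
  have hδ0 : ∀ x ∈ Finset.Icc (-(N : ℤ)) N, |δ x 0| ≤ 1 := by
    intro x hx
    have h1 := hr01 x 0
    have h2 := profile_mem (average_mem ha ha01 0) (average_mem hb hb01 0) hx
    simp only [hδ]
    rw [abs_le]
    constructor <;> linarith [h1.1, h1.2, h2.1, h2.2]
  have hδb := abs_le_barrier_of_lap (by positivity) hδd hFb hδ0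
  set g : ℤ → ℝ → ℝ := fun x u => oddExt N (fun z => δ z u) (x + 1) - oddExt N (fun z => δ z u) x
    with hg
  have hgmem : ∀ x ∈ Finset.Icc (-(N : ℤ)) (N - 1), ∀ u, g x u = δ (x + 1) u - δ x u := by
    intro x hx u
    rw [Finset.mem_Icc] at hx
    simp only [hg]
    rw [oddExt_of_mem _ (Finset.mem_Icc.2 (by omega)), oddExt_of_mem _ (Finset.mem_Icc.2 (by omega))]
  have hNmem : (N : ℤ) ∈ Finset.Icc (-(N : ℤ)) N := Finset.mem_Icc.2 (by omega)
  have hNmem' : (-N : ℤ) ∈ Finset.Icc (-(N : ℤ)) N := Finset.mem_Icc.2 (by omega)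
  have hgd : ∀ x ∈ Finset.Icc (-(N : ℤ)) (N - 1), HasRightDerivFrom 0 (g x)
      (fun u => (g (x + 1) u + g (x - 1) u - 2 * g x u) / 2 + (F (x + 1) u - F x u)) := by
    intro x hx
    have hx' := hx
    rw [Finset.mem_Icc] at hx'
    have m1 : x + 1 ∈ Finset.Icc (-(N : ℤ)) N := Finset.mem_Icc.2 (by omega)
    have m0 : x ∈ Finset.Icc (-(N : ℤ)) N := Finset.mem_Icc.2 (by omega)
    have := ((hδd _ m1).sub (hδd _ m0)).congr_deriv
      (g' := fun u => (g (x + 1) u + g (x - 1) u - 2 * g x u) / 2 + (F (x + 1) u - F x u))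
      fun u _ => by
        rw [lap_eq_oddExt _ m1, lap_eq_oddExt _ m0]
        simp only [hg, add_sub_cancel_right, sub_add_cancel]
        ring
    rwa [← funext (hgmem x hx)] at this
  have hgΓ : ∀ x ∈ Finset.Icc (-(N : ℤ)) (N - 1), ∀ u, 0 ≤ u →
      |F (x + 1) u - F x u| ≤ κ / N + if x = -N ∨ x = N - 1 then κ else 0 := by
    intro x hx u _
    rw [Finset.mem_Icc] at hx
    have h1 := abs_le.1 (abs_sub_average_le ha haL u)
    have h2 := abs_le.1 (abs_sub_average_le hb hbL u)
    have h3 := hstep a haL u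
    have h4 := hstep b hbL u
    have h5 : |profile N (a (u + 1) - a u) (b (u + 1) - b u) (x + 1) -
        profile N (a (u + 1) - a u) (b (u + 1) - b u) x| ≤ κ / N := by
      rw [profile_sub]
      refine le_trans ?_ (two_div_le hN hκ)
      rw [abs_div, abs_of_pos (show (0 : ℝ) < 2 * N + 1 by positivity)]
      gcongr
      rw [abs_le]
      constructor <;> linarith [h3.1, h3.2, h4.1, h4.2]
    rw [abs_le] at h5
    simp only [hF]
    have e1 : x ≠ N := by omega
    have e2 : x + 1 ≠ -N := by omega
    rw [if_neg e1, if_neg e2, abs_le]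
    split_ifs with h6 h7 h8 h7 h8 <;> first | omega | (constructor <;> linarith)
  -- On the ghost bond `g` is `-2 * δ N`, and the parabola at `N` equals only `2 * N + 1`; hence
  -- data of order `κ N` rather than `κ N²`.
  have hgr : ∀ u, 0 ≤ u →
      |g N u| ≤ (Real.exp (-relRate N * (u - 0)) + 2 * κ) * (4 * N + 2) := by
    intro u hu
    have h1 := hδb N hNmem u hu
    have h2 : g N u = -2 * δ N u := by
      simp only [hg]
      rw [oddExt_of_mem _ hNmem, oddExt, if_pos rfl]
      ring
    rw [h2, abs_mul, show |(-2 : ℝ)| = 2 by norm_num]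
    push_cast at h1
    nlinarith
  have hgl : ∀ u, 0 ≤ u →
      |g (-N - 1) u| ≤ (Real.exp (-relRate N * (u - 0)) + 2 * κ) * (4 * N + 2) := by
    intro u hu
    have h1 := hδb (-N) hNmem' u hu
    have h2 : g (-N - 1) u = 2 * δ (-N) u := by
      simp only [hg]
      rw [sub_add_cancel, oddExt_of_mem _ hNmem', oddExt, if_neg (by omega), if_pos rfl]
      ring
    rw [h2, abs_mul, abs_two]
    push_cast at h1
    nlinarith
  have hg0 : ∀ x ∈ Finset.Icc (-(N : ℤ)) (N - 1), |g x 0| ≤ 2 := by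
    intro x hx
    rw [hgmem x hx]
    rw [Finset.mem_Icc] at hx
    have h1 := hδ0 (x + 1) (Finset.mem_Icc.2 (by omega))
    have h2 := hδ0 x (Finset.mem_Icc.2 (by omega))
    exact (abs_sub _ _).trans (by linarith)
  intro x hx u hu
  have hmain := abs_le_barrier_of_heat hN hκ hgd hgΓ hgr hgl hg0 x hx u hu
  have he : g x u = r (x + 1) u - r x u - (average b u - average a u) / (2 * N + 1) := by
    rw [hgmem x hx, ← profile_sub N (average a u) (average b u) x]
    simp only [hδ]
    ring
  rw [he] at hmain
  refine hmain.trans ?_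
  have hxx : (0 : ℝ) ≤ (x : ℝ) * (x + 1) := by
    have : 0 ≤ x * (x + 1) := by
      rcases le_or_gt 0 x with h | h <;> nlinarith
    exact_mod_cast this
  have e := (Real.exp_pos (-relRate N * (u - 0))).le
  set E := Real.exp (-relRate N * (u - 0))
  have hq : (4 * E + κ / N) * (((N : ℝ) + 1) ^ 2 - (x : ℝ) * (x + 1)) ≤
      (4 * E + κ / N) * (4 * N ^ 2) := by
    refine mul_le_mul_of_nonneg_left ?_ (by positivity)
    nlinarith
  have hκN : κ / N * (4 * N ^ 2) = 4 * κ * N := by field_simp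
  have e1 : E * N ≤ E * N ^ 2 := mul_le_mul_of_nonneg_left (by nlinarith) e
  have e2 : E ≤ E * N := by nlinarith
  have e3 : κ ≤ κ * N := by nlinarith
  nlinarith

end Deterministic

/-! ### Equation for the correlations and comparison with the Green kernel. -/

section Deterministic

variable {N : ℕ} {κ : ℝ} {a b : ℝ → ℝ} {r : ℤ → ℝ → ℝ} {p : ℤ → ℤ → ℝ → ℝ}

theorem green_mem {x y : ℤ} (hx : -(N : ℤ) ≤ x) (hxy : x < y) (hy : y ≤ N) :
    green N x y ∈ Set.Icc (0 : ℝ) ((2 * N + 1) ^ 2) := by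
  have h1 : (-(N : ℝ)) ≤ x := by exact_mod_cast hx
  have h2 : (y : ℝ) ≤ N := by exact_mod_cast hy
  have h3 : (x : ℝ) ≤ y := by exact_mod_cast hxy.le
  unfold green
  refine ⟨mul_nonneg (by linarith) (by linarith), ?_⟩
  rw [sq]
  exact mul_le_mul (by linarith) (by linarith) (by linarith) (by positivity)

/-- The truncated correlations solve the two-particle equation, with the squared density gradient as
a source on neighbouring pairs. -/
theorem hasRightDerivFrom_cov {x y : ℤ} (hx : -(N : ℤ) ≤ x) (hxy : x < y) (hy : y ≤ N)
    (hr : ∀ x ∈ Finset.Icc (-(N : ℤ)) N, HasRightDerivFrom 0 (r x) (fun u =>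
      lap N (fun z => r z u) x + ((if x = N then b u else 0) + if x = -N then a u else 0)))
    (hp : HasRightDerivFrom 0 (p x y) (fun u =>
      lap₂ N (fun z z' => p z z' u) x y +
        ((if y = N then b u * r x u else 0) + if x = -N then a u * r y u else 0))) :
    HasRightDerivFrom 0 (fun u => p x y u - r x u * r y u) (fun u =>
      lap₂ N (fun z z' => p z z' u - r z u * r z' u) x y -
        if y = x + 1 then (r (x + 1) u - r x u) ^ 2 / 2 else 0) := by
  refine (hp.sub ((hr x (Finset.mem_Icc.2 (by omega))).mul
    (hr y (Finset.mem_Icc.2 (by omega))))).congr_deriv fun u _ => ?_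
  have hxN : x ≠ N := by omega
  have hyN : y ≠ -N := by omega
  unfold lap lap₂
  simp only [hxN, hyN, if_false]
  by_cases h : y = x + 1
  · subst h
    simp only [if_true, add_sub_cancel_right]
    split_ifs <;> ring
  · simp only [h, if_false]
    split_ifs <;> ring

/-- Adding the quasi-stationary value cancels the leading source. On neighbouring pairs there
remains the difference of the two squared gradients, small by `abs_grad_sub_le`; everywhere there is
the small term from the slow motion of `ĉ`. -/
theorem abs_cov_add_le (hN : 1 ≤ N) (ha : Continuous a) (hb : Continuous b)
    (ha01 : ∀ u, a u ∈ Set.Icc (0 : ℝ) 1) (hb01 : ∀ u, b u ∈ Set.Icc (0 : ℝ) 1)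
    (haL : ∀ u v, |a u - a v| ≤ κ * |u - v|) (hbL : ∀ u v, |b u - b v| ≤ κ * |u - v|)
    (hr : ∀ x ∈ Finset.Icc (-(N : ℤ)) N, HasRightDerivFrom 0 (r x) (fun u =>
      lap N (fun z => r z u) x + ((if x = N then b u else 0) + if x = -N then a u else 0)))
    (hr01 : ∀ x u, r x u ∈ Set.Icc (0 : ℝ) 1)
    (hp : ∀ x y, -(N : ℤ) ≤ x → x < y → y ≤ N → HasRightDerivFrom 0 (p x y) (fun u =>
      lap₂ N (fun z z' => p z z' u) x y +
        ((if y = N then b u * r x u else 0) + if x = -N then a u * r y u else 0)))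
    (hp0 : ∀ x y, p x y 0 = r x 0 * r y 0) {x y : ℤ} (hx : -(N : ℤ) ≤ x) (hxy : x < y)
    (hy : y ≤ N) {u : ℝ} (hu : 0 ≤ u) :
    N * |p x y u - r x u * r y u +
      ((average b u - average a u) / (2 * N + 1)) ^ 2 / (2 * N) * green N x y| ≤
        89 * (κ * N ^ 2) + 2916 * (κ * N ^ 2) ^ 2 + 3968 * (N ^ 7 * Real.exp (-relRate N * u)) := by
  have hκ : 0 ≤ κ := by simpa using (abs_nonneg _).trans (haL 1 0)
  have hN' : (1 : ℝ) ≤ N := by exact_mod_cast hN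
  have hn : (0 : ℝ) < 2 * N + 1 := by positivity
  set ĉ : ℝ → ℝ := fun u => (average b u - average a u) / (2 * N + 1) with hĉ
  set ĉ' : ℝ → ℝ := fun u => ((b (u + 1) - b u) - (a (u + 1) - a u)) / (2 * N + 1) with hĉ'
  set E : ℝ → ℝ := fun u => Real.exp (-relRate N * (u - 0)) with hE
  have hĉd : HasRightDerivFrom 0 ĉ ĉ' := .of_hasDerivAt fun u =>
    ((hasDerivAt_average hb u).sub (hasDerivAt_average ha u)).div_const _
  have hĉb : ∀ u, |ĉ u| ≤ 1 / (2 * N + 1) := fun u => by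
    have h1 := average_mem ha ha01 u
    have h2 := average_mem hb hb01 u
    simp only [hĉ]
    rw [abs_div, abs_of_pos hn]
    gcongr
    exact abs_le.2 ⟨by linarith [h1.2, h2.1], by linarith [h1.1, h2.2]⟩
  have hĉb' : ∀ u, |ĉ' u| ≤ 2 * κ / (2 * N + 1) := fun u => by
    have h1 := abs_le.1 (haL (u + 1) u)
    have h2 := abs_le.1 (hbL (u + 1) u)
    rw [add_sub_cancel_left, abs_one, mul_one] at h1 h2
    simp only [hĉ']
    rw [abs_div, abs_of_pos hn]
    gcongr
    exact abs_le.2 ⟨by linarith [h1.2, h2.1], by linarith [h1.1, h2.2]⟩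
  have hgrad := abs_grad_sub_le hN ha hb ha01 hb01 haL hbL hr hr01
  set w : ℤ → ℤ → ℝ → ℝ := fun x y u =>
    p x y u - r x u * r y u + ĉ u * ĉ u * (1 / (2 * N) * green N x y) with hw
  set R : ℤ → ℤ → ℝ → ℝ := fun x y u =>
    (if y = x + 1 then (ĉ u ^ 2 - (r (x + 1) u - r x u) ^ 2) / 2 else 0) +
      ĉ u * ĉ' u * (1 / N * green N x y) with hR
  have hwd : ∀ q ∈ pairs N, HasRightDerivFrom 0 (w q.1 q.2)
      (fun u => lap₂ N (fun x y => w x y u) q.1 q.2 + R q.1 q.2 u) := by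
    rintro ⟨x, y⟩ hq
    obtain ⟨h1, h2, h3⟩ := mem_pairs.1 hq
    simp only at h1 h2 h3 ⊢
    refine ((hasRightDerivFrom_cov h1 h2 h3 hr (hp x y h1 h2 h3)).add ((hĉd.mul hĉd).mul
      (.of_hasDerivAt (f := fun _ => 1 / (2 * N) * green N x y) (f' := fun _ => 0)
        fun u => hasDerivAt_const u _))).congr_deriv fun u _ => ?_
    have hlin : lap₂ N (fun x y => w x y u) x y =
        lap₂ N (fun z z' => p z z' u - r z u * r z' u) x y +
          ĉ u * ĉ u * (1 / (2 * N)) * lap₂ N (green N) x y := by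
      simp only [hw]
      unfold lap₂
      split_ifs <;> ring
    rw [hlin, lap₂_green]
    simp only [hR]
    split_ifs <;> field_simp <;> ring
  have hbound : ∀ q ∈ pairs N, ∀ u, 0 ≤ u → |R q.1 q.2 u| ≤
      (if q.2 = q.1 + 1 then (9 * κ + 324 * κ ^ 2 * N ^ 2) + (495 * N ^ 4) *
        Real.exp (-relRate N * (u - 0)) else 0) + 2 * κ / N := by
    rintro ⟨x, y⟩ hq u hu
    obtain ⟨h1, h2, h3⟩ := mem_pairs.1 hq
    simp only at h1 h2 h3 ⊢
    simp only [hR]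
    refine (abs_add_le _ _).trans (add_le_add ?_ ?_)
    · split_ifs with h
      · have h4 := hgrad x (Finset.mem_Icc.2 (by omega)) u hu
        set γ := r (x + 1) u - r x u - (average b u - average a u) / (2 * N + 1) with hγ
        have h5 : (ĉ u ^ 2 - (r (x + 1) u - r x u) ^ 2) / 2 = -(γ * (2 * ĉ u + γ)) / 2 := by
          simp only [hγ, hĉ]; ring
        have h6 : |2 * ĉ u + γ| ≤ 1 / N + (22 * N ^ 2 * E u + 18 * κ * N) := by
          refine (abs_add_le _ _).trans (add_le_add ?_ h4)
          rw [abs_mul, abs_two]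
          have h7 := two_div_le hN (zero_le_one (α := ℝ))
          have h8 := hĉb u
          rw [mul_one, show (2 : ℝ) / (2 * N + 1) = 2 * (1 / (2 * N + 1)) by ring] at h7
          linarith
        have hE0 : 0 ≤ E u := (Real.exp_pos _).le
        have hE1 : E u ≤ 1 := by
          refine Real.exp_le_one_iff.2 ?_
          have := relRate_nonneg N
          nlinarith
        have h7 : |γ * (2 * ĉ u + γ)| ≤ (22 * N ^ 2 * E u + 18 * κ * N) *
            (1 / N + (22 * N ^ 2 * E u + 18 * κ * N)) := by
          rw [abs_mul]
          exact mul_le_mul h4 h6 (abs_nonneg _) ((abs_nonneg _).trans h4)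
        rw [h5, abs_div, abs_neg, abs_two]
        have h8 : (22 * N ^ 2 * E u + 18 * κ * N) * (1 / N) = 22 * N * E u + 18 * κ := by
          field_simp
        -- By `(p + q)² ≤ 2 p² + 2 q²` and `E² ≤ E`, the transient enters linearly, as the barrier
        -- lemma requires.
        have h9 : (22 * N ^ 2 * E u + 18 * κ * N) ^ 2 ≤
            968 * N ^ 4 * E u + 648 * κ ^ 2 * N ^ 2 := by
          have h10 : (N : ℝ) ^ 4 * (E u) ^ 2 ≤ N ^ 4 * E u :=
            mul_le_mul_of_nonneg_left (by nlinarith) (by positivity)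
          nlinarith [sq_nonneg (22 * N ^ 2 * E u - 18 * κ * N)]
        have h11 : (N : ℝ) * E u ≤ N ^ 4 * E u :=
          mul_le_mul_of_nonneg_right (le_self_pow₀ hN' (by norm_num)) hE0
        change _ ≤ (9 * κ + 324 * κ ^ 2 * N ^ 2) + (495 * N ^ 4) * E u
        nlinarith
      · simp
    · have hG := green_mem h1 h2 h3
      rw [abs_mul, abs_mul, abs_of_nonneg (mul_nonneg (by positivity : (0 : ℝ) ≤ 1 / N) hG.1)]
      calc |ĉ u| * |ĉ' u| * (1 / N * green N x y)
          ≤ 1 / (2 * N + 1) * (2 * κ / (2 * N + 1)) * (1 / N * (2 * N + 1) ^ 2) := by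
            refine mul_le_mul (mul_le_mul (hĉb u) (hĉb' u) (abs_nonneg _) (by positivity))
              (mul_le_mul_of_nonneg_left hG.2 (by positivity))
              (mul_nonneg (by positivity) hG.1) (by positivity)
        _ = 2 * κ / N := by field_simp
  have hw0 : ∀ q ∈ pairs N, |w q.1 q.2 0| ≤ 1 := by
    rintro ⟨x, y⟩ hq
    obtain ⟨h1, h2, h3⟩ := mem_pairs.1 hq
    simp only at h1 h2 h3 ⊢
    have hG := green_mem h1 h2 h3
    simp only [hw]
    rw [hp0, sub_self, zero_add, abs_mul, abs_mul,
      abs_of_nonneg (mul_nonneg (by positivity : (0 : ℝ) ≤ 1 / (2 * N)) hG.1)]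
    calc |ĉ 0| * |ĉ 0| * (1 / (2 * N) * green N x y)
        ≤ 1 / (2 * N + 1) * (1 / (2 * N + 1)) * (1 / (2 * N) * (2 * N + 1) ^ 2) := by
          refine mul_le_mul (mul_le_mul (hĉb 0) (hĉb 0) (abs_nonneg _) (by positivity))
            (mul_le_mul_of_nonneg_left hG.2 (by positivity))
            (mul_nonneg (by positivity) hG.1) (by positivity)
      _ = 1 / (2 * N) := by field_simp
      _ ≤ 1 := by rw [div_le_one (by positivity)]; linarith
  have hmain := abs_le_barrier_of_lap₂ hN (by positivity) (by positivity) (by positivity) hwd hbound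
    hw0 (x, y) (mem_pairs.2 ⟨hx, hxy, hy⟩) u hu
  have hG := green_mem hx hxy hy
  simp only [sub_zero] at hmain
  have he : w x y u = p x y u - r x u * r y u + ĉ u ^ 2 / (2 * N) * green N x y := by
    simp only [hw]; ring
  rw [he] at hmain
  set E' := Real.exp (-relRate N * u)
  have hE0 : 0 ≤ E' := (Real.exp_pos _).le
  have h1 : (9 * κ + 324 * κ ^ 2 * N ^ 2) / N * green N x y ≤
      (9 * κ + 324 * κ ^ 2 * N ^ 2) / N * (9 * N ^ 2) :=
    mul_le_mul_of_nonneg_left (hG.2.trans (by nlinarith)) (by positivity)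
  have h2 : (2 * κ / N / 2 + (495 * N ^ 4 + 1) * E') *
      ((((N : ℝ) + 1) ^ 2 - (x : ℝ) ^ 2) + (((N : ℝ) + 1) ^ 2 - (y : ℝ) ^ 2)) ≤
      (2 * κ / N / 2 + (496 * N ^ 4) * E') * (8 * N ^ 2) := by
    have h4 : (1 : ℝ) ≤ N ^ 4 := one_le_pow₀ hN'
    have hxy0 : (((N : ℝ) + 1) ^ 2 - (x : ℝ) ^ 2) + (((N : ℝ) + 1) ^ 2 - (y : ℝ) ^ 2) ≤ 8 * N ^ 2 :=
      by nlinarith [sq_nonneg (x : ℝ), sq_nonneg (y : ℝ)]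
    refine (mul_le_mul_of_nonneg_left hxy0 (by positivity)).trans ?_
    gcongr
    linarith
  calc N * |p x y u - r x u * r y u + ĉ u ^ 2 / (2 * N) * green N x y|
      ≤ N * ((9 * κ + 324 * κ ^ 2 * N ^ 2) / N * (9 * N ^ 2) +
          (2 * κ / N / 2 + (496 * N ^ 4) * E') * (8 * N ^ 2)) := by
        refine mul_le_mul_of_nonneg_left (hmain.trans (add_le_add h1 h2)) (by positivity)
    _ = 89 * (κ * N ^ 2) + 2916 * (κ * N ^ 2) ^ 2 + 3968 * (N ^ 7 * E') := by
        field_simp; ring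

end Deterministic

/-! ### Quantitative correlation bounds for the process. -/

section Covariance

/-- The reservoir density at microscopic time `u`, frozen for `u < 0`. -/
noncomputable def microDensity (N : ℕ) (α : ℝ) (ρ : ℝ → ℝ) (u : ℝ) : ℝ :=
  ρ ((N : ℝ) ^ (-2 - α) * max u 0)

variable {N : ℕ} {α : ℝ} {ρ ρm ρp : ℝ → ℝ} {K : ℝ≥0}

theorem microDensity_mem (hρ : ∀ t, 0 ≤ t → ρ t ∈ Set.Ioo (0 : ℝ) 1) (u : ℝ) :
    microDensity N α ρ u ∈ Set.Icc (0 : ℝ) 1 :=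
  Set.Ioo_subset_Icc_self (hρ _ (by positivity))

theorem abs_microDensity_le (hρ : ∀ t, 0 ≤ t → ρ t ∈ Set.Ioo (0 : ℝ) 1) (u : ℝ) :
    |microDensity N α ρ u| ≤ 1 := by
  have := microDensity_mem (N := N) (α := α) hρ u
  exact abs_le.2 ⟨by linarith [this.1], this.2⟩

theorem abs_microDensity_sub_le (hL : LipschitzOnWith K ρ (Set.Ici 0)) (u v : ℝ) :
    |microDensity N α ρ u - microDensity N α ρ v| ≤ (K * (N : ℝ) ^ (-2 - α)) * |u - v| := by
  have h0 : (0 : ℝ) ≤ (N : ℝ) ^ (-2 - α) := by positivity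
  have h := hL.dist_le_mul ((N : ℝ) ^ (-2 - α) * max u 0) (by simp; positivity)
    ((N : ℝ) ^ (-2 - α) * max v 0) (by simp; positivity)
  rw [Real.dist_eq, Real.dist_eq, ← mul_sub, abs_mul, abs_of_nonneg h0] at h
  refine h.trans ?_
  rw [mul_assoc]
  exact mul_le_mul_of_nonneg_left
    (mul_le_mul_of_nonneg_left (abs_max_sub_max_le_abs u v 0) h0) K.coe_nonneg

theorem continuous_microDensity (hL : LipschitzOnWith K ρ (Set.Ici 0)) :
    Continuous (microDensity N α ρ) := by
  refine (LipschitzWith.of_dist_le_mul (K := K * (N : ℝ≥0) ^ (-2 - α)) fun u v => ?_).continuous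
  rw [Real.dist_eq, Real.dist_eq]
  simpa using abs_microDensity_sub_le (N := N) (α := α) hL u v

theorem microDensity_of_nonneg {u : ℝ} (hu : 0 ≤ u) :
    ρ ((N : ℝ) ^ (-2 - α) * u) = microDensity N α ρ u := by
  rw [microDensity, max_eq_left hu]

variable {Ω : Type*} [MeasurableSpace Ω] {X : ℝ≥0 → Ω → Config N} {P : Measure Ω}
  {η₀ : Config N}

theorem meanOcc_eq (x : Site N) (t : ℝ≥0) :
    meanOcc P X x t = weightedMean P X (fun _ => 1) (occZ (x : ℤ)) t := by
  simp [meanOcc, weightedMean, occZ_coe]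

variable [IsProbabilityMeasure P]

theorem integrable_comp (hm : ∀ t, StronglyMeasurable (X t)) (f : Config N → ℝ) (t : ℝ≥0) :
    Integrable (fun ω => f (X t ω)) P := by
  simpa using integrable_mul_comp (P := P) (Z := fun _ => 1) (c := 1) hm measurable_const
    (by simp) f t

theorem weightedMean_one_mem (hm : ∀ t, StronglyMeasurable (X t)) (x : ℤ) (u : ℝ) :
    weightedMean P X (fun _ => 1) (occZ x) u ∈ Set.Icc (0 : ℝ) 1 := by
  simp only [weightedMean, one_mul]
  refine ⟨integral_nonneg fun ω => (occZ_mem x _).1, ?_⟩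
  have := integral_mono (μ := P) (integrable_comp hm (occZ x) u.toNNReal)
    (integrable_const (1 : ℝ)) fun ω => (occZ_mem x _).2
  simpa using this

theorem equalTimeCov_eq (hm : ∀ t, StronglyMeasurable (X t)) (x y : Site N) (t : ℝ≥0) :
    equalTimeCov P X x y t =
      weightedMean P X (fun _ => 1) (fun η => occZ (x : ℤ) η * occZ (y : ℤ) η) t -
        weightedMean P X (fun _ => 1) (occZ (x : ℤ)) t *
          weightedMean P X (fun _ => 1) (occZ (y : ℤ)) t := by
  rw [equalTimeCov, twoTimeCov, ← meanOcc_eq, ← meanOcc_eq]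
  have hx : ∫ ω, occ (X t ω) x ∂P = meanOcc P X x t := rfl
  have hy : ∫ ω, occ (X t ω) y ∂P = meanOcc P X y t := rfl
  set mx := meanOcc P X x t
  set my := meanOcc P X y t
  have h : ∀ ω, (occ (X t ω) x - mx) * (occ (X t ω) y - my) =
      (occ (X t ω) x * occ (X t ω) y - my * occ (X t ω) x) - (mx * occ (X t ω) y - mx * my) :=
    fun ω => by ring
  have i1 := integrable_comp (P := P) hm (fun η => occ η x * occ η y) t
  have i2 := (integrable_comp (P := P) hm (fun η => occ η x) t).const_mul my
  have i3 := (integrable_comp (P := P) hm (fun η => occ η y) t).const_mul mx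
  have i12 : Integrable (fun ω => occ (X t ω) x * occ (X t ω) y - my * occ (X t ω) x) P :=
    i1.sub i2
  have i34 : Integrable (fun ω => mx * occ (X t ω) y - mx * my) P := i3.sub (integrable_const _)
  simp only [h]
  rw [integral_sub i12 i34, integral_sub i1 i2, integral_sub i3 (integrable_const _),
    integral_const_mul, integral_const_mul, hx, hy]
  simp [weightedMean, occZ_coe]
  ring

/-- Quantitative comparison of the equal-time correlations with their quasi-stationary value. -/
theorem abs_equalTimeCov_add_le (hN : 1 ≤ N) (hρm : ∀ t, 0 ≤ t → ρm t ∈ Set.Ioo (0 : ℝ) 1)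
    (hρp : ∀ t, 0 ≤ t → ρp t ∈ Set.Ioo (0 : ℝ) 1) (hLm : LipschitzOnWith K ρm (Set.Ici 0))
    (hLp : LipschitzOnWith K ρp (Set.Ici 0)) (hX : IsExclusionProcess α ρm ρp η₀ P X)
    {x y : Site N} (hxy : (x : ℤ) < y) (t : ℝ≥0) :
    N * |equalTimeCov P X x y t + ((average (microDensity N α ρp) t -
        average (microDensity N α ρm) t) / (2 * N + 1)) ^ 2 / (2 * N) * green N x y| ≤
      89 * (K * (N : ℝ) ^ (-2 - α) * N ^ 2) + 2916 * (K * (N : ℝ) ^ (-2 - α) * N ^ 2) ^ 2 +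
        3968 * (N ^ 7 * Real.exp (-relRate N * t)) := by
  have hca := continuous_microDensity (N := N) (α := α) hLm
  have hcb := continuous_microDensity (N := N) (α := α) hLp
  have hr : ∀ x ∈ Finset.Icc (-(N : ℤ)) N, HasRightDerivFrom 0
      (weightedMean P X (fun _ => 1) (occZ x)) (fun u =>
        lap N (fun z => weightedMean P X (fun _ => 1) (occZ z) u) x +
          ((if x = N then microDensity N α ρp u else 0) +
            if x = -N then microDensity N α ρm u else 0)) := by
    intro x hx
    have := hasRightDerivFrom_occZ (s := 0) (Z := fun _ => 1) (c := 1) hN hX hca hcb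
      (abs_microDensity_le hρm) (abs_microDensity_le hρp) (fun u hu => microDensity_of_nonneg hu)
      (fun u hu => microDensity_of_nonneg hu) stronglyMeasurable_const (by simp) hx
    simpa using this
  have hp : ∀ x y, -(N : ℤ) ≤ x → x < y → y ≤ N → HasRightDerivFrom 0
      (weightedMean P X (fun _ => 1) (fun η => occZ x η * occZ y η)) (fun u =>
        lap₂ N (fun z z' => weightedMean P X (fun _ => 1) (fun η => occZ z η * occZ z' η) u) x y +
        ((if y = N then microDensity N α ρp u * weightedMean P X (fun _ => 1) (occZ x) u else 0) +
          if x = -N then microDensity N α ρm u * weightedMean P X (fun _ => 1) (occZ y) u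
            else 0)) := by
    intro x y h1 h2 h3
    have := hasRightDerivFrom_occZ_mul (s := 0) (Z := fun _ => 1) (c := 1) hX hca hcb
      (abs_microDensity_le hρm) (abs_microDensity_le hρp) (fun u hu => microDensity_of_nonneg hu)
      (fun u hu => microDensity_of_nonneg hu) stronglyMeasurable_const (by simp) h1 h2 h3
    simpa using this
  -- The start is deterministic, so second moments factorize at time 0.
  have h0 : ∀ f : Config N → ℝ, weightedMean P X (fun _ => 1) f 0 = f η₀ := by
    intro f
    have : (fun ω => (1 : ℝ) * f (X (0 : ℝ).toNNReal ω)) =ᵐ[P] fun _ => f η₀ := by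
      filter_upwards [hX.initial] with ω hω
      rw [Real.toNNReal_zero, hω, one_mul]
    rw [weightedMean, integral_congr_ae this]
    simp
  have := abs_cov_add_le (p := fun x y => weightedMean P X (fun _ => 1)
      (fun η => occZ x η * occZ y η)) (r := fun x => weightedMean P X (fun _ => 1) (occZ x))
    hN hca hcb (microDensity_mem hρm) (microDensity_mem hρp)
    (abs_microDensity_sub_le hLm) (abs_microDensity_sub_le hLp) hr
    (weightedMean_one_mem hX.measurable) hp (fun x y => by simp only [h0]) x.2.1 hxy y.2.2
    t.coe_nonneg
  rwa [equalTimeCov_eq hX.measurable]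

/-- Exponential decay of the two-time correlations. -/
theorem abs_twoTimeCov_le (hN : 1 ≤ N) (hρm : ∀ t, 0 ≤ t → ρm t ∈ Set.Ioo (0 : ℝ) 1)
    (hρp : ∀ t, 0 ≤ t → ρp t ∈ Set.Ioo (0 : ℝ) 1) (hLm : LipschitzOnWith K ρm (Set.Ici 0))
    (hLp : LipschitzOnWith K ρp (Set.Ici 0)) (hX : IsExclusionProcess α ρm ρp η₀ P X)
    (x y : Site N) {s t : ℝ≥0} (hst : s ≤ t) :
    |twoTimeCov P X x s y t| ≤ Real.exp (-relRate N * (t - s)) * ((N : ℝ) + 1) ^ 2 := by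
  have hm := hX.measurable
  have hmean := weightedMean_one_mem (P := P) hm x s
  rw [← meanOcc_eq] at hmean
  set Z : Ω → ℝ := fun ω => occ (X s ω) x - meanOcc P X x s with hZ
  have hZs : StronglyMeasurable[Filtration.natural X hm s] Z := by
    have h1 : StronglyMeasurable[Filtration.natural X hm s] (X s) :=
      Filtration.stronglyAdapted_natural hm s
    exact (((measurable_of_finite fun η : Config N => occ η x).comp
      h1.measurable).sub_const _).stronglyMeasurable
  have hZ1 : ∀ ω, |Z ω| ≤ 1 := fun ω => by
    have := occZ_mem (x : ℤ) (X s ω)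
    rw [occZ_coe] at this
    exact abs_le.2 ⟨by linarith [this.1, hmean.2], by linarith [this.2, hmean.1]⟩
  have hZm : Measurable Z := (hZs.mono ((Filtration.natural X hm).le s)).measurable
  -- Centring removes the reservoir source, leaving pure decay from time `s`.
  have hZ0 : ∫ ω, Z ω ∂P = 0 := by
    rw [hZ, integral_sub (integrable_comp hm (fun η => occ η x) s) (integrable_const _)]
    simp [meanOcc]
  have hd : ∀ z ∈ Finset.Icc (-(N : ℤ)) N, HasRightDerivFrom s (weightedMean P X Z (occZ z))
      (fun u => lap N (fun z => weightedMean P X Z (occZ z) u) z + 0) := by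
    intro z hz
    have := hasRightDerivFrom_occZ hN hX (continuous_microDensity hLm) (continuous_microDensity hLp)
      (abs_microDensity_le hρm) (abs_microDensity_le hρp) (fun u hu => microDensity_of_nonneg hu)
      (fun u hu => microDensity_of_nonneg hu) hZs hZ1 hz
    simpa only [hZ0, mul_zero] using this
  have h0 : ∀ z ∈ Finset.Icc (-(N : ℤ)) N, |weightedMean P X Z (occZ z) s| ≤ 1 := by
    intro z _
    have h := norm_integral_le_of_norm_le_const (μ := P) (C := 1)
      (f := fun ω => Z ω * occZ z (X (s : ℝ).toNNReal ω)) (Eventually.of_forall fun ω => ?_)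
    · simpa [weightedMean] using h
    · have h2 := occZ_mem z (X (s : ℝ).toNNReal ω)
      rw [norm_mul, Real.norm_eq_abs, Real.norm_eq_abs, abs_of_nonneg h2.1]
      exact mul_le_one₀ (hZ1 ω) h2.1 h2.2
  have hmain := abs_le_barrier_of_lap (f := fun z => weightedMean P X Z (occZ z))
    (F := fun _ _ => 0) le_rfl hd (by simp) h0 y (Finset.mem_Icc.2 y.2) t (by exact_mod_cast hst)
  -- As `Z` has mean zero, the occupation at the later time need not be centred.
  have he : twoTimeCov P X x s y t = weightedMean P X Z (occZ (y : ℤ)) t := by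
    have h : ∀ ω, (occ (X s ω) x - meanOcc P X x s) * (occ (X t ω) y - meanOcc P X y t) =
        Z ω * occ (X t ω) y - meanOcc P X y t * Z ω := fun ω => by simp only [hZ]; ring
    have hZi : Integrable Z P := Integrable.of_bound hZm.aestronglyMeasurable 1
      (Eventually.of_forall hZ1)
    rw [twoTimeCov]
    simp only [h]
    rw [integral_sub (integrable_mul_comp hm hZm hZ1 (fun η => occ η y) t) (hZi.const_mul _),
      integral_const_mul, hZ0]
    simp [weightedMean, occZ_coe]
  rw [he]
  refine hmain.trans ?_
  rw [add_zero]
  gcongr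
  nlinarith [sq_nonneg ((y : ℤ) : ℝ)]

end Covariance

/-! ### Asymptotics in `N`. -/

section Asymptotics

theorem coe_microTime (N : ℕ) (α : ℝ) (t : ℝ≥0) :
    ((microTime N α t : ℝ≥0) : ℝ) = (N : ℝ) ^ (2 + α) * t := by
  simp [microTime]

theorem microDensity_microTime {N : ℕ} (hN : 1 ≤ N) (α : ℝ) (ρ : ℝ → ℝ) (t : ℝ≥0) :
    microDensity N α ρ (microTime N α t) = ρ t := by
  have hN' : (0 : ℝ) < N := by exact_mod_cast hN
  rw [← microDensity_of_nonneg (NNReal.coe_nonneg _), coe_microTime, ← mul_assoc,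
    ← Real.rpow_add hN']
  ring_nf
  simp

/-- Macroscopic time measured in relaxation times is of order `N^α`; the constant `1/8` comes from
`N + 1 ≤ 2 N`. -/
theorem le_relRate_mul {N : ℕ} (hN : 1 ≤ N) (α : ℝ) {c : ℝ} (hc : 0 ≤ c) :
    c / 8 * (N : ℝ) ^ α ≤ relRate N * ((N : ℝ) ^ (2 + α) * c) := by
  have hN' : (1 : ℝ) ≤ N := by exact_mod_cast hN
  have hpos : (0 : ℝ) < N := by linarith
  have h1 : (N : ℝ) ^ (2 + α) = N ^ 2 * (N : ℝ) ^ α := by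
    rw [Real.rpow_add hpos]; norm_cast
  have h2 : (1 : ℝ) / 8 ≤ relRate N * N ^ 2 := by
    rw [relRate, div_mul_eq_mul_div, div_le_div_iff₀ (by norm_num) (by positivity)]
    nlinarith
  have h3 : 0 ≤ c * (N : ℝ) ^ α := by positivity
  rw [h1]
  nlinarith [mul_le_mul_of_nonneg_right h2 h3]

theorem tendsto_pow_mul_exp_neg_rpow {α c : ℝ} (hα : 0 < α) (hc : 0 < c) (k : ℕ) :
    Tendsto (fun N : ℕ => (N : ℝ) ^ k * Real.exp (-c * (N : ℝ) ^ α)) atTop (𝓝 0) := by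
  have h := (tendsto_rpow_mul_exp_neg_mul_atTop_nhds_zero (k / α) c hc).comp
    ((tendsto_rpow_atTop hα).comp tendsto_natCast_atTop_atTop)
  refine h.congr fun N => ?_
  simp only [Function.comp_apply]
  rw [← Real.rpow_mul (Nat.cast_nonneg N), mul_div_cancel₀ _ hα.ne', Real.rpow_natCast]

theorem tendsto_pow_mul_exp_relRate {α c : ℝ} (hα : 0 < α) (hc : 0 < c) (k : ℕ) :
    Tendsto (fun N : ℕ => (N : ℝ) ^ k * Real.exp (-relRate N * ((N : ℝ) ^ (2 + α) * c)))
      atTop (𝓝 0) := by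
  refine tendsto_of_tendsto_of_tendsto_of_le_of_le' tendsto_const_nhds
    (tendsto_pow_mul_exp_neg_rpow hα (show 0 < c / 8 by positivity) k)
    (Eventually.of_forall fun N => by positivity) ?_
  filter_upwards [eventually_ge_atTop 1] with N hN
  have := le_relRate_mul hN α hc.le
  exact mul_le_mul_of_nonneg_left (Real.exp_le_exp.2 (by linarith)) (by positivity)

theorem tendsto_microLipschitz {α : ℝ} (hα : 0 < α) (K : ℝ) :
    Tendsto (fun N : ℕ => K * (N : ℝ) ^ (-2 - α) * N ^ 2) atTop (𝓝 0) := by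
  have h := ((tendsto_rpow_neg_atTop hα).comp tendsto_natCast_atTop_atTop).const_mul K
  rw [mul_zero] at h
  refine h.congr' ?_
  filter_upwards [eventually_ge_atTop 1] with N hN
  have hN' : (0 : ℝ) < N := by exact_mod_cast hN
  simp only [Function.comp_apply]
  rw [mul_assoc, ← Real.rpow_natCast, ← Real.rpow_add hN']
  congr 2
  push_cast
  ring

theorem tendsto_average_microDensity {α : ℝ} (hα : 0 < α) {ρ : ℝ → ℝ} {K : ℝ≥0}
    (hL : LipschitzOnWith K ρ (Set.Ici 0)) (t : ℝ≥0) :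
    Tendsto (fun N : ℕ => average (microDensity N α ρ) (microTime N α t)) atTop (𝓝 (ρ t)) := by
  rw [tendsto_iff_norm_sub_tendsto_zero]
  refine tendsto_of_tendsto_of_tendsto_of_le_of_le' tendsto_const_nhds
    (tendsto_microLipschitz hα K) (Eventually.of_forall fun N => norm_nonneg _) ?_
  filter_upwards [eventually_ge_atTop 1] with N hN
  have hN' : (1 : ℝ) ≤ N := by exact_mod_cast hN
  have h := abs_sub_average_le (continuous_microDensity (N := N) (α := α) hL)
    (abs_microDensity_sub_le hL) (microTime N α t)
  rw [microDensity_microTime hN, abs_sub_comm] at h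
  refine h.trans (le_mul_of_one_le_right (by positivity) (one_le_pow₀ hN'))

/-- This is the first factor of `green` divided by `2 * N + 1`; the second factor, so divided, is 1
minus the same expression at the other site. -/
theorem tendsto_floor_div (r : ℝ) :
    Tendsto (fun N : ℕ => ((N : ℝ) + 1 / 2 + ⌊(N : ℝ) * r⌋) / (2 * N + 1)) atTop
      (𝓝 ((1 + r) / 2)) := by
  rw [tendsto_iff_norm_sub_tendsto_zero]
  have h0 : Tendsto (fun N : ℕ => (1 + |r|) * (1 / ((N : ℝ) + 1))) atTop (𝓝 0) := by
    simpa using (tendsto_one_div_add_atTop_nhds_zero_nat (𝕜 := ℝ)).const_mul (1 + |r|)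
  refine squeeze_zero (fun N => norm_nonneg _) (fun N => ?_) h0
  have hn : (0 : ℝ) < 2 * N + 1 := by positivity
  have h1 := Int.floor_le ((N : ℝ) * r)
  have h2 := Int.lt_floor_add_one ((N : ℝ) * r)
  have he : ((N : ℝ) + 1 / 2 + ⌊(N : ℝ) * r⌋) / (2 * N + 1) - (1 + r) / 2 =
      (⌊(N : ℝ) * r⌋ - N * r - r / 2) / (2 * N + 1) := by
    field_simp; ring
  rw [he, Real.norm_eq_abs, abs_div, abs_of_pos hn, mul_one_div]
  have h3 : |(⌊(N : ℝ) * r⌋ - N * r - r / 2 : ℝ)| ≤ 1 + |r| := by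
    have := abs_le.1 (le_refl |r|)
    have := abs_nonneg r
    exact abs_le.2 ⟨by linarith, by linarith⟩
  exact div_le_div₀ (by positivity) h3 (by positivity) (by linarith [Nat.cast_nonneg (α := ℝ) N])

end Asymptotics

end QuasiStatic

/-! ### The two limits. -/

theorem theorem2
    (α : ℝ) (hα : 0 < α)
    (ρm ρp : ℝ → ℝ)
    (hρm : ∀ t, 0 ≤ t → ρm t ∈ Set.Ioo (0 : ℝ) 1)
    (hρp : ∀ t, 0 ≤ t → ρp t ∈ Set.Ioo (0 : ℝ) 1)
    (hLm : ∃ K : ℝ≥0, LipschitzOnWith K ρm (Set.Ici 0))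
    (hLp : ∃ K : ℝ≥0, LipschitzOnWith K ρp (Set.Ici 0))
    (η₀ : ∀ N : ℕ, QuasiStatic.Config N)
    (Ω : ℕ → Type*) [∀ N, MeasurableSpace (Ω N)]
    (P : ∀ N, Measure (Ω N)) [∀ N, IsProbabilityMeasure (P N)]
    (X : ∀ N, ℝ≥0 → Ω N → QuasiStatic.Config N)
    (hX : ∀ N, 1 ≤ N → QuasiStatic.IsExclusionProcess α ρm ρp (η₀ N) (P N) (X N)) :
    (∀ (r₁ r₂ : ℝ) (hr₁ : r₁ ∈ Set.Ioo (-1 : ℝ) 1) (hr₂ : r₂ ∈ Set.Ioo (-1 : ℝ) 1), r₁ < r₂ →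
      ∀ t : ℝ≥0, 0 < t →
        Tendsto
          (fun N : ℕ => (N : ℝ) * QuasiStatic.equalTimeCov (P N) (X N)
            (QuasiStatic.macroSite N r₁ hr₁) (QuasiStatic.macroSite N r₂ hr₂)
            (QuasiStatic.microTime N α t))
          atTop
          (𝓝 (-(1 / 4) * (ρp t - ρm t) ^ 2 * ((1 + r₁) * (1 - r₂) / 2)))) ∧
    (∀ s t : ℝ≥0, s < t → ∀ x y : ∀ N : ℕ, QuasiStatic.Site N,
        Tendsto
          (fun N : ℕ => (N : ℝ) * QuasiStatic.twoTimeCov (P N) (X N)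
            (x N) (QuasiStatic.microTime N α s) (y N) (QuasiStatic.microTime N α t))
          atTop (𝓝 0)) := by
  obtain ⟨Km, hKm⟩ := hLm
  obtain ⟨Kp, hKp⟩ := hLp
  set K : ℝ≥0 := max Km Kp
  have hLm : LipschitzOnWith K ρm (Set.Ici 0) := hKm.weaken (le_max_left _ _)
  have hLp : LipschitzOnWith K ρp (Set.Ici 0) := hKp.weaken (le_max_right _ _)
  constructor
  · intro r₁ r₂ hr₁ hr₂ hr t ht
    have ht' : (0 : ℝ) < t := by exact_mod_cast ht
    have herr : Tendsto (fun N : ℕ => 89 * (K * (N : ℝ) ^ (-2 - α) * N ^ 2) +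
        2916 * (K * (N : ℝ) ^ (-2 - α) * N ^ 2) ^ 2 +
        3968 * ((N : ℝ) ^ 7 * Real.exp (-QuasiStatic.relRate N * ((N : ℝ) ^ (2 + α) * t))))
        atTop (𝓝 0) := by
      have h1 := QuasiStatic.tendsto_microLipschitz hα K
      have h2 := QuasiStatic.tendsto_pow_mul_exp_relRate hα ht' 7
      simpa using ((h1.const_mul 89).add ((h1.pow 2).const_mul 2916)).add (h2.const_mul 3968)
    set J : ℕ → ℝ := fun N =>
      QuasiStatic.average (QuasiStatic.microDensity N α ρp) (QuasiStatic.microTime N α t) -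
        QuasiStatic.average (QuasiStatic.microDensity N α ρm) (QuasiStatic.microTime N α t) with hJ
    have hJlim : Tendsto J atTop (𝓝 (ρp t - ρm t)) :=
      (QuasiStatic.tendsto_average_microDensity hα hLp t).sub
        (QuasiStatic.tendsto_average_microDensity hα hLm t)
    set G : ℕ → ℝ := fun N => (((N : ℝ) + 1 / 2 + ⌊(N : ℝ) * r₁⌋) / (2 * N + 1)) *
      (1 - ((N : ℝ) + 1 / 2 + ⌊(N : ℝ) * r₂⌋) / (2 * N + 1)) with hG
    have hGlim : Tendsto G atTop (𝓝 ((1 + r₁) / 2 * (1 - (1 + r₂) / 2))) :=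
      (QuasiStatic.tendsto_floor_div r₁).mul ((QuasiStatic.tendsto_floor_div r₂).const_sub 1)
    -- The factor `1/2` stems from the source `-(∇ρ_N)²/2`; the limit of `G` is `(1 + r₁) * (1 - r₂)
    -- / 4`.
    have hquasi : Tendsto (fun N => -(1 / 2) * J N ^ 2 * G N) atTop
        (𝓝 (-(1 / 4) * (ρp t - ρm t) ^ 2 * ((1 + r₁) * (1 - r₂) / 2))) := by
      convert ((hJlim.pow 2).const_mul (-(1 / 2))).mul hGlim using 2
      ring
    have hdiff : Tendsto (fun N : ℕ => (N : ℝ) * QuasiStatic.equalTimeCov (P N) (X N)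
        (QuasiStatic.macroSite N r₁ hr₁) (QuasiStatic.macroSite N r₂ hr₂)
        (QuasiStatic.microTime N α t) - -(1 / 2) * J N ^ 2 * G N) atTop (𝓝 0) := by
      refine squeeze_zero_norm' ?_ herr
      -- From then on the integer parts are distinct and correctly ordered.
      have hlarge : ∀ᶠ N : ℕ in atTop, 1 ≤ (N : ℝ) * (r₂ - r₁) :=
        (tendsto_natCast_atTop_atTop.atTop_mul_const (sub_pos.2 hr)).eventually_ge_atTop 1
      filter_upwards [eventually_ge_atTop 1, hlarge] with N hN hNr
      have hN' : (0 : ℝ) < N := by exact_mod_cast hN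
      have hlt : ((QuasiStatic.macroSite N r₁ hr₁ : QuasiStatic.Site N) : ℤ) <
          (QuasiStatic.macroSite N r₂ hr₂ : QuasiStatic.Site N) := by
        change ⌊(N : ℝ) * r₁⌋ < ⌊(N : ℝ) * r₂⌋
        rw [← Int.add_one_le_iff, Int.le_floor]
        push_cast
        linarith [Int.floor_le ((N : ℝ) * r₁)]
      have h := QuasiStatic.abs_equalTimeCov_add_le hN hρm hρp hLm hLp (hX N hN) hlt
        (QuasiStatic.microTime N α t)
      rw [QuasiStatic.coe_microTime] at h
      refine le_trans (le_of_eq ?_) h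
      rw [Real.norm_eq_abs, ← abs_of_pos hN', ← abs_mul, abs_of_pos hN']
      congr 1
      simp only [hJ, hG, QuasiStatic.green, QuasiStatic.macroSite, QuasiStatic.coe_microTime]
      field_simp
      ring
    simpa using hdiff.add hquasi
  · intro s t hst x y
    have hst' : (0 : ℝ) < t - s := sub_pos.2 (by exact_mod_cast hst)
    have h := (QuasiStatic.tendsto_pow_mul_exp_relRate hα hst' 3).const_mul 4
    rw [mul_zero] at h
    refine squeeze_zero_norm' ?_ h
    filter_upwards [eventually_ge_atTop 1] with N hN
    have hN' : (1 : ℝ) ≤ N := by exact_mod_cast hN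
    have hle : QuasiStatic.microTime N α s ≤ QuasiStatic.microTime N α t :=
      mul_le_mul_of_nonneg_left hst.le zero_le
    have h := QuasiStatic.abs_twoTimeCov_le hN hρm hρp hLm hLp (hX N hN) (x N) (y N) hle
    rw [QuasiStatic.coe_microTime, QuasiStatic.coe_microTime, ← mul_sub] at h
    rw [norm_mul, Real.norm_eq_abs, Real.norm_eq_abs, abs_of_nonneg (by positivity)]
    set E := Real.exp (-QuasiStatic.relRate N * ((N : ℝ) ^ (2 + α) * (t - s)))
    have hE : 0 ≤ E := (Real.exp_pos _).le
    calc (N : ℝ) * |QuasiStatic.twoTimeCov (P N) (X N) (x N) (QuasiStatic.microTime N α s) (y N)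
          (QuasiStatic.microTime N α t)| ≤ N * (E * (4 * N ^ 2)) := by
          refine mul_le_mul_of_nonneg_left (h.trans ?_) (by positivity)
          exact mul_le_mul_of_nonneg_left (by nlinarith) hE
      _ = 4 * (N ^ 3 * E) := by ring
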